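/- Notation. Let \(\mathcal X,\mathcal Y\) be finite sets and let \(\mathcal P(\mathcal X)\) be the set of probability mass functions on \(\mathcal X\). Let \(W\) be a stochastic matrix from \(\mathcal X\) to \(\mathcal Y\), with entries \(W(y|x)\). For \(P\in\mathcal P(\mathcal X)\) define the order-\(\alpha\) Rényi information by \[ I_\alpha(P;W)=\frac{\alpha}{\alpha-1}\ln\sum_{y}\Big[\sum_{x}P(x)\,W(y|x)^{\alpha}\Big]^{1/\alpha}\quad(0<\alpha<1), \] \[ I_1(P;W)=\sum_x P(x)\sum_y W(y|x)\ln\frac{W(y|x)}{\sum_{x'}P(x')W(y|x')}. \] The order-\(\alpha\) Rényi capacity is \(C_\alpha(W)=\sup_{P\in\mathcal P(\mathcal X)}I_\alpha(P;W)\) for \(\alpha\in(0,1]\), and \(C_0(W)=\lim_{\alpha\downarrow0}C_\alpha(W)\). The sphere packing exponent is \(E_{sp}(R,W)=\sup_{\alpha\in(0,1)}\frac{1-\alpha}{\alpha}\,(C_\alpha(W)-R)\in[0,\infty]\). An input of the length-\(n\) discrete stationary product channel (DSPC) with feedback whose components all equal \(W\) is a tuple \(\vec x=(\vec x_1,\dots,\vec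 x_n)\) with \(\vec x_1\in\mathcal X\) and \(\vec x_t:\mathcal Y^{t-1}\to\mathcal X\) for \(2\le t\le n\). Given \(\vec x\), the output sequence \(y_1^n=(y_1,\dots,y_n)\in\mathcal Y^n\) has probability \(\vec W(y_1^n|\vec x)=\prod_{t=1}^n W\big(y_t\,\big|\,\vec x_t(y_1,\dots,y_{t-1})\big)\). A rate-\(R\) code on this channel consists of an encoder \(\Psi\) from the message set \(\mathcal M=\{1,\dots,\lceil e^{nR}\rceil\}\) to the set of inputs, and a decoder \(\Theta:\mathcal Y^n\to\mathcal M\). Its average error probability is \[ P_{e,\mathrm{av}}=\frac1{\lceil e^{nR}\rceil}\sum_{m\in\mathcal M}\Big(1-\sum_{y_1^n:\,\Theta(y_1^n)=m}\vec W(y_1^n|\Psi(m))\Big). \] Theorem. Let \(W\) be a stochastic matrix from \(\mathcal X\) to \(\mathcal Y\) with \(C_0(W)\ne C_1(W)\), and let \(R_0,R_1\) satisfy \(C_0(W)<R_0<R_1<C_1(W)\). Then there is an \(n_0\), depending only on \(W,R_0,R_1\), such that for every \(n\ge n_0\), every \(R\) with \[ R_1>R>R_0+\frac{2\ln n}{n^{1/3}},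 \] and every rate-\(R\) code on the length-\(n\) DSPC with feedback whose components all equal \(W\), \[ P_{e,\mathrm{av}}\ \ge\ \exp\Big(-n\Big[E_{sp}\Big(R-\frac{2\ln n}{n^{1/3}},W\Big)+\frac{2\ln n}{n^{1/3}}\Big]\Big). \] -/

import Mathlib

noncomputable section

/-- `W` is a stochastic matrix from `X` to `Y`: each row `W x = W(· | x)` is a probability mass
function on `Y`. -/
def IsStochasticMatrix {X Y : Type*} [Fintype Y] (W : Matrix X Y ℝ) : Prop :=
  ∀ x, W x ∈ stdSimplex ℝ Y

/-- The output distribution `q_{1,P}(y) = ∑ x, P x * W(y | x)`. -/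
def outputPmf {X Y : Type*} [Fintype X] (P : X → ℝ) (W : Matrix X Y ℝ) (y : Y) : ℝ :=
  ∑ x, P x * W x y

/-- The order-`α` Rényi information for prior `P`, for `α ∈ (0, 1]`. (For `α = 1` the conventions
`0 ln 0 = 0` and `0 · ∞ = 0` hold since `Real.log 0 = 0`.) -/
def renyiInformation {X Y : Type*} [Fintype X] [Fintype Y]
    (α : ℝ) (P : X → ℝ) (W : Matrix X Y ℝ) : ℝ :=
  if α = 1 then
    ∑ x, P x * ∑ y, W x y * Real.log (W x y / outputPmf P W y)
  else
    α / (α - 1) * Real.log (∑ y, (∑ x, P x * W x y ^ α) ^ (1 / α))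

/-- The order-`α` Rényi capacity, for `α ∈ (0, 1]`: the supremum of the order-`α` Rényi information
over all priors. -/
def renyiCapacity {X Y : Type*} [Fintype X] [Fintype Y] (α : ℝ) (W : Matrix X Y ℝ) : ℝ :=
  sSup ((fun P : X → ℝ => renyiInformation α P W) '' stdSimplex ℝ X)

/-- The order-`0` Rényi capacity: the limit of the order-`α` Rényi capacity as `α ↓ 0`. -/
def renyiCapacityZero {X Y : Type*} [Fintype X] [Fintype Y] (W : Matrix X Y ℝ) : ℝ :=
  Filter.limUnder (nhdsWithin (0 : ℝ) (Set.Ioi 0)) (fun α : ℝ => renyiCapacity α W)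

/-- The sphere packing exponent, an extended real number (it is `⊤` below the order-`0`
capacity). -/
def spherePackingExponent {X Y : Type*} [Fintype X] [Fintype Y]
    (R : ℝ) (W : Matrix X Y ℝ) : EReal :=
  ⨆ α ∈ Set.Ioo (0 : ℝ) 1, (((1 - α) / α * (renyiCapacity α W - R) : ℝ) : EReal)

/-- The inputs of a length-`n` channel with feedback: for each time `t`, a function giving the
channel input at time `t` from the channel outputs at all earlier times. -/
abbrev FeedbackInput (X Y : Type*) (n : ℕ) : Type _ :=
  (t : Fin n) → ((Fin (t : ℕ) → Y) → X)

/-- The outputs strictly before time `t`. -/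
def pastOutputs {Y : Type*} {n : ℕ} (y : Fin n → Y) (t : Fin n) : Fin (t : ℕ) → Y :=
  fun s => y (Fin.castLE t.isLt.le s)

/-- The length-`n` discrete product channel with feedback with components `W t`: the probability of
the output sequence `y` given the input `x`. -/
def feedbackChannel {X Y : Type*} {n : ℕ} (W : Fin n → Matrix X Y ℝ)
    (x : FeedbackInput X Y n) (y : Fin n → Y) : ℝ :=
  ∏ t : Fin n, W t (x t (pastOutputs y t)) (y t)

/-- The number `⌈e^{nR}⌉` of messages. -/
def numMessages (n : ℕ) (R : ℝ) : ℕ := ⌈Real.exp (n * R)⌉₊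

/-- A rate-`R` channel code (encoder and decoder) on a length-`n` channel with feedback. -/
structure FeedbackCode (X Y : Type*) (n : ℕ) (R : ℝ) where
  enc : Fin (numMessages n R) → FeedbackInput X Y n
  dec : (Fin n → Y) → Fin (numMessages n R)

/-- The conditional error probability of the message `m`. -/
def FeedbackCode.errorProb {X Y : Type*} [Fintype Y] {n : ℕ} {R : ℝ}
    (c : FeedbackCode X Y n R) (W : Fin n → Matrix X Y ℝ) (m : Fin (numMessages n R)) : ℝ :=
  1 - ∑ y : Fin n → Y, (if c.dec y = m then 1 else 0) * feedbackChannel W (c.enc m) y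

/-- The average error probability of a code. -/
def FeedbackCode.avgErrorProb {X Y : Type*} [Fintype Y] {n : ℕ} {R : ℝ}
    (c : FeedbackCode X Y n R) (W : Fin n → Matrix X Y ℝ) : ℝ :=
  1 / (numMessages n R : ℝ) * ∑ m, c.errorProb W m

/-- The approximation error term `2 ln n / n^{1/3}`. -/
def approxError (n : ℕ) : ℝ := 2 * Real.log n / (n : ℝ) ^ ((1 : ℝ) / 3)

end

/-!
Fix a target rate `R' = R - approxError n`. For a single channel use with input `x`, let `q` be the
Rényi center of order `s`, so that every row of `W` has order-`s` Rényi divergence at most `C_s`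
from `q` (`exists_renyiCenter`). The tilted distribution `v ∝ W(·|x) ^ s * q ^ (1 - s)` satisfies
`s D(v‖W(·|x)) + (1 - s) D(v‖q) ≤ (1 - s) C_s`. If `s` is chosen with `D(v‖q) = R'`, then
`D(v‖W(·|x)) ≤ (1 - s) / s * (C_s - R') ≤ E_sp(R')`, and a change of measure from `W` to `v` would
give the sphere packing bound, except that `q` depends on `s` and therefore on the message.

The dependence is removed by averaging over the orders (`exists_averaged_center`): the average `Q`
of the product centers of the orders `k / N` serves all orders at once and costs only `log N`. Since
the tilting is towards the fixed `Q`, the relative entropy `D(v‖Q)` is continuous in the order, and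
the order comes from the intermediate value theorem (`exists_tilting_order`). To keep the
total cost small, this is done not per channel use but per block of about `n ^ (1 / 3)` uses, with
the order chosen anew in each block given the past outputs; a feedback input of a block satisfies
the same divergence bound as the memoryless ones (`le_hellinger_strategyProb`). There are about
`n ^ (2 / 3)` blocks, so the averaging costs about `n ^ (2 / 3) * log n / 3` in total.

Concentration of the log-likelihood ratios `log (V / Q)` and `log (V / W)` of the whole sequence is
proved through exponential moments, which multiply under concatenation of blocks
(`MomentBound.append`). Inside a block the log-likelihood ratio has exponential moments on the scale
of the block length (`tilted_moments`), because `∑ v (w / q) ^ (1 - s)` and `∑ v (w / q) ^ (-s)` are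
controlled by the Rényi divergence of order `s`; hence the fluctuations are of order
`n ^ (1 / 3) * √(n ^ (2 / 3)) = n ^ (2 / 3)`, again below `n * approxError n`. Markov's inequality
and the change of measure for the decoding regions, whose `Q`-probabilities sum to one,
conclude (`avgErrorProb_ge_of_momentBound`).
-/

open Finset

/-! ### Tilting one probability vector towards another -/

/-- The Hellinger integral `∑ w ^ s * q ^ (1 - s)` of order `s`; for probability vectors its
logarithm is `(s - 1)` times the order-`s` Rényi divergence of `w` from `q`. -/
noncomputable def hellinger {ι : Type*} [Fintype ι] (w q : ι → ℝ) (s : ℝ) : ℝ :=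
  ∑ i, w i ^ s * q i ^ (1 - s)

/-- The order-`s` tilted probability vector between `w` and `q`, proportional to
`w ^ s * q ^ (1 - s)`. -/
noncomputable def tilted {ι : Type*} [Fintype ι] (w q : ι → ℝ) (s : ℝ) (i : ι) : ℝ :=
  w i ^ s * q i ^ (1 - s) / hellinger w q s

/-- The mean of the log-likelihood ratio `log (w / q)` under the order-`s` tilted vector. Where
`w i = 0` the ratio has the junk value `0`, which is harmless since `tilted w q s i = 0` there.

With `v = tilted w q s`, `m` this mean and `Z = hellinger w q s`, the relative entropies are
`D(v‖q) = s * m - log Z` and `D(v‖w) = -(1 - s) * m - log Z`. -/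
noncomputable def tiltedMean {ι : Type*} [Fintype ι] (w q : ι → ℝ) (s : ℝ) : ℝ :=
  ∑ i, tilted w q s i * Real.log (w i / q i)

section Tilting

variable {ι : Type*} [Fintype ι] {w q : ι → ℝ} {s : ℝ}

lemma hellinger_pos (hw : w ∈ stdSimplex ℝ ι) (hq : ∀ i, 0 < q i) : 0 < hellinger w q s := by
  have hex : ∃ i ∈ (univ : Finset ι), 0 < w i := by
    apply exists_lt_of_sum_lt
    simp [hw.2]
  obtain ⟨i, -, hi⟩ := hex
  refine sum_pos' (fun j _ => ?_) ⟨i, mem_univ i, ?_⟩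
  · exact mul_nonneg (Real.rpow_nonneg (hw.1 j) _) (Real.rpow_nonneg (hq j).le _)
  · exact mul_pos (Real.rpow_pos_of_pos hi _) (Real.rpow_pos_of_pos (hq i) _)

lemma tilted_mem_stdSimplex (hw : w ∈ stdSimplex ℝ ι) (hq : ∀ i, 0 < q i) :
    tilted w q s ∈ stdSimplex ℝ ι := by
  refine ⟨fun i => div_nonneg (mul_nonneg (Real.rpow_nonneg (hw.1 i) _)
    (Real.rpow_nonneg (hq i).le _)) (hellinger_pos hw hq).le, ?_⟩
  unfold tilted
  rw [← sum_div]
  exact div_self (hellinger_pos hw hq).ne'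

lemma tilted_eq_zero (hs : s ≠ 0) {i : ι} (hi : w i = 0) : tilted w q s i = 0 := by
  simp [tilted, hi, Real.zero_rpow hs]

lemma tilted_div_right (hw : w ∈ stdSimplex ℝ ι) (hq : ∀ i, 0 < q i) {i : ι} (hi : 0 < w i) :
    tilted w q s i / q i =
      Real.exp (s * Real.log (w i / q i) - Real.log (hellinger w q s)) := by
  rw [Real.exp_sub, Real.exp_log (hellinger_pos hw hq), mul_comm s, ← Real.rpow_def_of_pos
    (div_pos hi (hq i)), Real.div_rpow hi.le (hq i).le, tilted, Real.rpow_sub (hq i), Real.rpow_one]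
  have := hq i
  have := Real.rpow_pos_of_pos (hq i) s
  field_simp

lemma tilted_div_left (hw : w ∈ stdSimplex ℝ ι) (hq : ∀ i, 0 < q i) {i : ι} (hi : 0 < w i) :
    tilted w q s i / w i =
      Real.exp (-(1 - s) * Real.log (w i / q i) - Real.log (hellinger w q s)) := by
  have h : tilted w q s i / w i = tilted w q s i / q i / (w i / q i) := by
    have := hq i
    field_simp
  rw [h, tilted_div_right hw hq hi]
  nth_rw 2 [← Real.exp_log (div_pos hi (hq i))]
  rw [← Real.exp_sub]
  ring_nf

lemma sum_tilted_mul_exp_le_left (hw : w ∈ stdSimplex ℝ ι) (hq : ∀ i, 0 < q i) (hs : s ≠ 0) :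
    ∑ i, tilted w q s i * Real.exp ((1 - s) * Real.log (w i / q i)) ≤
      Real.exp (-Real.log (hellinger w q s)) := by
  have h : ∀ i, tilted w q s i * Real.exp ((1 - s) * Real.log (w i / q i)) =
      w i * Real.exp (-Real.log (hellinger w q s)) := by
    intro i
    rcases (hw.1 i).eq_or_lt with hi | hi
    · rw [tilted_eq_zero hs hi.symm, ← hi]; simp
    · have := tilted_div_left (s := s) hw hq hi
      rw [div_eq_iff hi.ne'] at this
      rw [this, mul_right_comm, ← Real.exp_add, mul_comm]
      ring_nf
  rw [sum_congr rfl fun i _ => h i, ← sum_mul, hw.2, one_mul]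

lemma sum_tilted_mul_exp_le_right (hw : w ∈ stdSimplex ℝ ι) (hq : ∀ i, 0 < q i)
    (hq1 : ∑ i, q i = 1) (hs : s ≠ 0) :
    ∑ i, tilted w q s i * Real.exp (-s * Real.log (w i / q i)) ≤
      Real.exp (-Real.log (hellinger w q s)) := by
  have h : ∀ i, tilted w q s i * Real.exp (-s * Real.log (w i / q i)) ≤
      q i * Real.exp (-Real.log (hellinger w q s)) := by
    intro i
    rcases (hw.1 i).eq_or_lt with hi | hi
    · rw [tilted_eq_zero hs hi.symm, zero_mul]
      exact mul_nonneg (hq i).le (Real.exp_pos _).le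
    · have := tilted_div_right (s := s) hw hq hi
      rw [div_eq_iff (hq i).ne'] at this
      rw [this, mul_right_comm, ← Real.exp_add, mul_comm]
      ring_nf
      exact le_rfl
  calc _ ≤ ∑ i, q i * Real.exp (-Real.log (hellinger w q s)) := sum_le_sum fun i _ => h i
    _ = _ := by rw [← sum_mul, hq1, one_mul]

/-- Jensen's inequality for the exponential, on the logarithmic scale. -/
lemma le_of_sum_mul_exp_le {v X : ι → ℝ} (hv : v ∈ stdSimplex ℝ ι) {a b : ℝ}
    (h : ∑ i, v i * Real.exp (a * X i) ≤ Real.exp b) : a * ∑ i, v i * X i ≤ b := by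
  have := convexOn_exp.map_sum_le (t := univ) (w := v) (p := fun i => a * X i)
    (fun i _ => hv.1 i) hv.2 (fun i _ => Set.mem_univ _)
  simp only [smul_eq_mul] at this
  have := Real.exp_le_exp.1 (this.trans h)
  rw [mul_sum]
  refine le_trans (le_of_eq ?_) this
  exact sum_congr rfl fun i _ => by ring

/-- Interpolation of exponential moments between the exponents `0` and `a`. -/
lemma sum_mul_exp_le_of_sum_mul_exp_le {v X : ι → ℝ} (hv : v ∈ stdSimplex ℝ ι) {a t M : ℝ}
    (ht : 0 ≤ t) (hta : t ≤ a) (ha : 0 < a) (h : ∑ i, v i * Real.exp (a * X i) ≤ Real.exp (a * M)) :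
    ∑ i, v i * Real.exp (t * X i) ≤ Real.exp (t * M) := by
  have key : ∀ i, Real.exp (t * (X i - M)) ≤ (1 - t / a) + t / a * Real.exp (a * (X i - M)) := by
    intro i
    have := convexOn_exp.2 (Set.mem_univ 0) (Set.mem_univ (a * (X i - M)))
      (show 0 ≤ 1 - t / a by rw [sub_nonneg, div_le_one ha]; exact hta)
      (show 0 ≤ t / a by positivity) (by ring)
    simp only [smul_eq_mul, mul_zero, zero_add, Real.exp_zero, mul_one] at this
    rwa [← mul_assoc, div_mul_cancel₀ _ ha.ne'] at this
  have e1 : ∀ c : ℝ, ∑ i, v i * Real.exp (c * X i) =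
      (∑ i, v i * Real.exp (c * (X i - M))) * Real.exp (c * M) := by
    intro c
    rw [sum_mul]
    refine sum_congr rfl fun i _ => ?_
    rw [mul_assoc, ← Real.exp_add]
    ring_nf
  rw [e1] at h ⊢
  have h1 : ∑ i, v i * Real.exp (a * (X i - M)) ≤ 1 := by
    have := Real.exp_pos (a * M)
    by_contra! hc
    nlinarith
  have h2 : ∑ i, v i * Real.exp (t * (X i - M)) ≤ 1 := by
    calc _ ≤ ∑ i, v i * ((1 - t / a) + t / a * Real.exp (a * (X i - M))) :=
          sum_le_sum fun i _ => mul_le_mul_of_nonneg_left (key i) (hv.1 i)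
      _ = (1 - t / a) * ∑ i, v i + t / a * ∑ i, v i * Real.exp (a * (X i - M)) := by
          rw [mul_sum, mul_sum, ← sum_add_distrib]
          exact sum_congr rfl fun i _ => by ring
      _ ≤ 1 := by
          rw [hv.2]
          have : 0 ≤ t / a := by positivity
          nlinarith
  have := Real.exp_pos (t * M)
  nlinarith

/-- A variable with exponential moments of orders `± t` has moment generating function bounded by
that of a Gaussian of variance of order `b / t ^ 2`, for arguments `h` with `|h| ≤ t / 2`. -/
lemma sum_mul_exp_le_exp_quadratic {v X : ι → ℝ} (hv : v ∈ stdSimplex ℝ ι) {t b h : ℝ}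
    (ht : 0 < t) (h1 : ∑ i, v i * Real.exp (t * X i) ≤ b)
    (h2 : ∑ i, v i * Real.exp (-t * X i) ≤ b) (hh : |h| ≤ t / 2) :
    ∑ i, v i * Real.exp (h * X i) ≤
      Real.exp (h * ∑ i, v i * X i + 16 * b * (h / t) ^ 2) := by
  have taylor : ∀ x : ℝ, Real.exp x ≤ 1 + x + x ^ 2 * Real.exp |x| := by
    intro x
    have := Complex.norm_exp_sub_sum_le_norm_mul_exp (x : ℂ) 2
    simp only [sum_range_succ, range_zero, sum_empty, zero_add, pow_zero, Nat.factorial_zero,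
      Nat.cast_one, div_one, pow_one, Nat.factorial_one, Complex.norm_real, Real.norm_eq_abs,
      sq_abs] at this
    rw [← Complex.ofReal_exp, ← Complex.ofReal_one, ← Complex.ofReal_add, ← Complex.ofReal_sub,
      Complex.norm_real, Real.norm_eq_abs] at this
    linarith [le_abs_self (Real.exp x - (1 + x))]
  have key : ∀ x : ℝ, Real.exp (h * x) ≤
      1 + h * x + 8 * (h / t) ^ 2 * (Real.exp (t * x) + Real.exp (-t * x)) := by
    intro x
    have e1 : Real.exp |h * x| ≤ Real.exp (t * |x| / 2) := by
      apply Real.exp_le_exp.2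
      rw [abs_mul]
      nlinarith [abs_nonneg x]
    have e2 : (t * |x|) ^ 2 ≤ 8 * Real.exp (t * |x| / 2) := by
      have := Real.quadratic_le_exp_of_nonneg (x := t * |x| / 2) (by positivity)
      have : 0 ≤ t * |x| := by positivity
      nlinarith
    have e3 : Real.exp (t * |x| / 2) * Real.exp (t * |x| / 2) ≤
        Real.exp (t * x) + Real.exp (-t * x) := by
      rw [← Real.exp_add, add_halves]
      rcases abs_cases x with ⟨hx, -⟩ | ⟨hx, -⟩
      · rw [hx]; linarith [Real.exp_pos (-t * x)]
      · rw [hx, mul_neg, ← neg_mul]; linarith [Real.exp_pos (t * x)]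
    have e4 : (h * x) ^ 2 = (h / t) ^ 2 * (t * |x|) ^ 2 := by
      rw [mul_pow t, sq_abs]
      field_simp
    have e5 : (h * x) ^ 2 * Real.exp |h * x| ≤
        8 * (h / t) ^ 2 * (Real.exp (t * x) + Real.exp (-t * x)) := by
      rw [e4]
      calc (h / t) ^ 2 * (t * |x|) ^ 2 * Real.exp |h * x|
          ≤ (h / t) ^ 2 * (8 * Real.exp (t * |x| / 2)) * Real.exp (t * |x| / 2) := by gcongr
        _ = 8 * (h / t) ^ 2 * (Real.exp (t * |x| / 2) * Real.exp (t * |x| / 2)) := by ring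
        _ ≤ _ := by gcongr
    linarith [taylor (h * x)]
  calc ∑ i, v i * Real.exp (h * X i)
      ≤ ∑ i, v i * (1 + h * X i +
          8 * (h / t) ^ 2 * (Real.exp (t * X i) + Real.exp (-t * X i))) :=
        sum_le_sum fun i _ => mul_le_mul_of_nonneg_left (key _) (hv.1 i)
    _ = ∑ i, v i + h * ∑ i, v i * X i + 8 * (h / t) ^ 2 *
          (∑ i, v i * Real.exp (t * X i) + ∑ i, v i * Real.exp (-t * X i)) := by
        rw [← sum_add_distrib, mul_sum, mul_sum, ← sum_add_distrib, ← sum_add_distrib]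
        exact sum_congr rfl fun i _ => by ring
    _ ≤ 1 + (h * ∑ i, v i * X i + 16 * b * (h / t) ^ 2) := by
        rw [hv.2]
        have : 0 ≤ (h / t) ^ 2 := by positivity
        nlinarith
    _ ≤ _ := by linarith [Real.add_one_le_exp (h * ∑ i, v i * X i + 16 * b * (h / t) ^ 2)]

lemma continuousOn_hellinger (hq : ∀ i, 0 < q i) :
    ContinuousOn (hellinger w q) (Set.Ioi 0) := by
  unfold hellinger
  intro a ha
  refine ContinuousAt.continuousWithinAt ?_
  refine tendsto_finsetSum _ fun i _ => ?_
  refine ContinuousAt.mul ?_ ?_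
  · exact ContinuousAt.rpow continuousAt_const continuousAt_id (Or.inr ha)
  · exact ContinuousAt.rpow continuousAt_const (by fun_prop) (Or.inl (hq i).ne')

lemma continuousOn_tiltedMean (hw : w ∈ stdSimplex ℝ ι) (hq : ∀ i, 0 < q i) :
    ContinuousOn (tiltedMean w q) (Set.Ioi 0) := by
  unfold tiltedMean tilted
  refine continuousOn_finsetSum _ fun i _ => ContinuousOn.mul (ContinuousOn.div ?_
    (continuousOn_hellinger hq) fun a _ => (hellinger_pos hw hq).ne') continuousOn_const
  intro a ha
  refine ContinuousAt.continuousWithinAt (ContinuousAt.mul ?_ ?_)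
  · exact ContinuousAt.rpow continuousAt_const continuousAt_id (Or.inr ha)
  · exact ContinuousAt.rpow continuousAt_const (by fun_prop) (Or.inl (hq i).ne')

/-- The relative entropy of the tilted vector from `q` is nonnegative. -/
lemma tilted_relEntropy_right_nonneg (hw : w ∈ stdSimplex ℝ ι) (hq : ∀ i, 0 < q i)
    (hq1 : ∑ i, q i = 1) (hs : s ≠ 0) :
    0 ≤ s * tiltedMean w q s - Real.log (hellinger w q s) := by
  have := le_of_sum_mul_exp_le (tilted_mem_stdSimplex hw hq)
    (sum_tilted_mul_exp_le_right (s := s) hw hq hq1 hs)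
  unfold tiltedMean
  linarith

/-- The relative entropy of the tilted vector from `w` is nonnegative. -/
lemma tilted_relEntropy_left_nonneg (hw : w ∈ stdSimplex ℝ ι) (hq : ∀ i, 0 < q i)
    (hs : s ≠ 0) :
    0 ≤ -(1 - s) * tiltedMean w q s - Real.log (hellinger w q s) := by
  have := le_of_sum_mul_exp_le (tilted_mem_stdSimplex hw hq)
    (sum_tilted_mul_exp_le_left (s := s) hw hq hs)
  unfold tiltedMean
  linarith

/-- Choice of the tilting order. If the Rényi divergence of order `a₀` is at most `T`, then either
some order `s ∈ [a₀, a₁]` makes the relative entropy of the tilted vector from `q` equal to `T`, or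
`s = a₁` keeps it below `T`; in both cases the hypotheses turn the identity
`s D(v‖w) + (1 - s) D(v‖q) = - log (hellinger w q s)` into a bound `G` on `D(v‖w)`. -/
lemma exists_tilting_order (hw : w ∈ stdSimplex ℝ ι) (hq : ∀ i, 0 < q i)
    (hq1 : ∑ i, q i = 1) {a₀ a₁ T G : ℝ} (h0 : 0 < a₀) (h01 : a₀ ≤ a₁) (h1 : a₁ < 1)
    (hT : -Real.log (hellinger w q a₀) ≤ (1 - a₀) * T)
    (hG : ∀ s ∈ Set.Icc a₀ a₁, -Real.log (hellinger w q s) ≤ (1 - s) * T + s * G)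
    (hG1 : -Real.log (hellinger w q a₁) ≤ a₁ * G) :
    ∃ s ∈ Set.Icc a₀ a₁, s * tiltedMean w q s - Real.log (hellinger w q s) ≤ T ∧
      -(1 - s) * tiltedMean w q s - Real.log (hellinger w q s) ≤ G := by
  set f : ℝ → ℝ := fun s => s * tiltedMean w q s - Real.log (hellinger w q s) with hf
  have hsub : Set.Icc a₀ a₁ ⊆ Set.Ioi 0 := fun s hs => h0.trans_le hs.1
  have hcont : ContinuousOn f (Set.Icc a₀ a₁) := by
    refine ContinuousOn.sub (continuousOn_id.mul ((continuousOn_tiltedMean hw hq).mono hsub)) ?_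
    exact ((continuousOn_hellinger hq).mono hsub).log fun s _ => (hellinger_pos hw hq).ne'
  have hfa : f a₀ ≤ T := by
    have := tilted_relEntropy_left_nonneg (s := a₀) hw hq h0.ne'
    have h1' : (1 - a₀) * f a₀ ≤ (1 - a₀) * T := by
      simp only [hf]
      nlinarith
    exact le_of_mul_le_mul_left h1' (by linarith)
  rcases le_or_gt T (f a₁) with hcase | hcase
  · obtain ⟨s, hs, hsT⟩ := intermediate_value_Icc h01 hcont ⟨hfa, hcase⟩
    refine ⟨s, hs, hsT.le, ?_⟩
    have := hG s hs
    have hs0 : 0 < s := hsub hs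
    refine le_of_mul_le_mul_left ?_ hs0
    simp only [hf] at hsT
    rw [← hsT] at this
    linarith
  · refine ⟨a₁, ⟨h01, le_rfl⟩, hcase.le, ?_⟩
    have hs0 : 0 < a₁ := h0.trans_le h01
    have := tilted_relEntropy_right_nonneg (s := a₁) hw hq hq1 hs0.ne'
    refine le_of_mul_le_mul_left ?_ hs0
    nlinarith

/-- Monotonicity of the Rényi divergence in the order, for orders in `(0, 1)`. -/
lemma exp_neg_le_hellinger_of_le (hw : w ∈ stdSimplex ℝ ι) (hq : ∀ i, 0 ≤ q i) {a b D : ℝ}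
    (ha : 0 < a) (hab : a ≤ b) (hb : b < 1)
    (h : Real.exp (-((1 - b) * D)) ≤ hellinger w q b) :
    Real.exp (-((1 - a) * D)) ≤ hellinger w q a := by
  have hb' : 0 < 1 - b := by linarith
  have e : ∀ c : ℝ, 0 < c → ∀ i, w i ^ c * q i ^ (1 - c) = w i * (q i / w i) ^ (1 - c) := by
    intro c hc i
    rcases (hw.1 i).eq_or_lt with hi | hi
    · rw [← hi, Real.zero_rpow hc.ne']; simp
    · rw [Real.div_rpow (hq i) hi.le, Real.rpow_sub hi, Real.rpow_one]
      have := Real.rpow_pos_of_pos hi c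
      field_simp
  have hp : 1 ≤ (1 - a) / (1 - b) := by rw [one_le_div hb']; linarith
  have J := Real.rpow_arith_mean_le_arith_mean_rpow univ w (fun i => (q i / w i) ^ (1 - b))
    (fun i _ => hw.1 i) hw.2
    (fun i _ => Real.rpow_nonneg (div_nonneg (hq i) (hw.1 i)) _) hp
  have e1 : ∑ i, w i * (q i / w i) ^ (1 - b) = hellinger w q b :=
    sum_congr rfl fun i _ => (e b (ha.trans_le hab) i).symm
  have e2 : ∑ i, w i * ((q i / w i) ^ (1 - b)) ^ ((1 - a) / (1 - b)) = hellinger w q a := by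
    refine sum_congr rfl fun i _ => ?_
    rw [e a ha i, ← Real.rpow_mul (div_nonneg (hq i) (hw.1 i)), mul_div_cancel₀ _ hb'.ne']
  rw [e1, e2] at J
  refine le_trans ?_ J
  calc Real.exp (-((1 - a) * D)) = Real.exp (-((1 - b) * D)) ^ ((1 - a) / (1 - b)) := by
        rw [← Real.exp_mul]
        congr 1
        field_simp
    _ ≤ _ := Real.rpow_le_rpow (Real.exp_pos _).le h (by positivity)

/-- Exponential moments of the two log-likelihood ratios `log (v / q)` and `log (v / w)` under the
tilted vector `v`, in terms of the relative entropies and of a bound `D` on the Rényi divergence. -/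
lemma tilted_moments (hw : w ∈ stdSimplex ℝ ι) (hq : ∀ i, 0 < q i)
    (hq1 : ∑ i, q i = 1) {D t l c T G : ℝ} (hs0 : 0 < s) (hs1 : s < 1)
    (hD : -Real.log (hellinger w q s) ≤ (1 - s) * D) (hD0 : 0 ≤ D)
    (ht : 0 < t) (hts : t ≤ s) (hts' : t ≤ 1 - s)
    (hc : t / s * D ≤ c) (hl : 0 ≤ l) (hlt : l ≤ t / 2)
    (hT : s * tiltedMean w q s - Real.log (hellinger w q s) ≤ T)
    (hG : -(1 - s) * tiltedMean w q s - Real.log (hellinger w q s) ≤ G) :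
    ∑ i, tilted w q s i * (tilted w q s i / q i) ^ l ≤
        Real.exp (l * T + 16 * Real.exp c * (l / t) ^ 2) ∧
      ∑ i, tilted w q s i * (tilted w q s i / w i) ^ l ≤
        Real.exp (l * G + 16 * Real.exp c * (l / t) ^ 2) := by
  have hv := tilted_mem_stdSimplex (s := s) hw hq
  set L : ι → ℝ := fun i => Real.log (w i / q i) with hL
  set Λ := Real.log (hellinger w q s) with hΛ
  have hcD : t * D ≤ c := by
    refine le_trans ?_ hc
    gcongr
    rw [le_div_iff₀ hs0]
    nlinarith
  have b1 : ∑ i, tilted w q s i * Real.exp (t * L i) ≤ Real.exp c := by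
    refine (sum_mul_exp_le_of_sum_mul_exp_le hv (M := D) ht.le hts' (by linarith) ?_).trans
      (Real.exp_le_exp.2 hcD)
    exact (sum_tilted_mul_exp_le_left hw hq hs0.ne').trans (Real.exp_le_exp.2 hD)
  have b2 : ∑ i, tilted w q s i * Real.exp (-t * L i) ≤ Real.exp c := by
    have := sum_mul_exp_le_of_sum_mul_exp_le hv (X := fun i => -L i) (M := (1 - s) * D / s)
      ht.le hts hs0 ?_
    · simp only [mul_neg, ← neg_mul] at this
      refine this.trans (Real.exp_le_exp.2 (le_trans ?_ hc))
      rw [div_mul_eq_mul_div, mul_div_assoc']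
      gcongr
      nlinarith
    · simp only [mul_neg, ← neg_mul]
      refine (sum_tilted_mul_exp_le_right hw hq hq1 hs0.ne').trans (Real.exp_le_exp.2 ?_)
      rw [mul_div_cancel₀ _ hs0.ne']
      exact hD
  have quad : ∀ {r : ℝ}, |r| ≤ 1 → ∑ i, tilted w q s i * Real.exp ((r * l) * L i) ≤
      Real.exp (r * l * tiltedMean w q s + 16 * Real.exp c * (l / t) ^ 2) := by
    intro r hr
    have hrl : |r * l| ≤ l := by
      rw [abs_mul, abs_of_nonneg hl]
      nlinarith
    refine (sum_mul_exp_le_exp_quadratic hv ht b1 b2 (hrl.trans hlt)).trans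
      (Real.exp_le_exp.2 ?_)
    have : (r * l / t) ^ 2 ≤ (l / t) ^ 2 := by
      rw [sq_le_sq, abs_div, abs_div]
      exact div_le_div_of_nonneg_right (hrl.trans (le_abs_self l)) (abs_nonneg t)
    unfold tiltedMean
    have h16 : 0 < 16 * Real.exp c := by positivity
    nlinarith
  constructor
  · have e : ∀ i, tilted w q s i * (tilted w q s i / q i) ^ l =
        tilted w q s i * Real.exp ((s * l) * L i) * Real.exp (-(l * Λ)) := by
      intro i
      rcases (hw.1 i).eq_or_lt with hi | hi
      · rw [tilted_eq_zero hs0.ne' hi.symm]; simp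
      · rw [tilted_div_right hw hq hi, ← Real.exp_mul, mul_assoc, ← Real.exp_add]
        congr 2
        ring
    rw [sum_congr rfl fun i _ => e i, ← sum_mul]
    have := quad (r := s) (by rw [abs_of_pos hs0]; exact hs1.le)
    refine (mul_le_mul_of_nonneg_right this (Real.exp_pos _).le).trans ?_
    rw [← Real.exp_add]
    apply Real.exp_le_exp.2
    nlinarith
  · have e : ∀ i, tilted w q s i * (tilted w q s i / w i) ^ l =
        tilted w q s i * Real.exp ((-(1 - s) * l) * L i) * Real.exp (-(l * Λ)) := by
      intro i
      rcases (hw.1 i).eq_or_lt with hi | hi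
      · rw [tilted_eq_zero hs0.ne' hi.symm]; simp
      · rw [tilted_div_left hw hq hi, ← Real.exp_mul, mul_assoc, ← Real.exp_add]
        congr 2
        ring
    rw [sum_congr rfl fun i _ => e i, ← sum_mul]
    have := quad (r := -(1 - s)) (by rw [abs_neg, abs_of_pos (by linarith)]; linarith)
    refine (mul_le_mul_of_nonneg_right this (Real.exp_pos _).le).trans ?_
    rw [← Real.exp_add]
    apply Real.exp_le_exp.2
    nlinarith

end Tilting

/-! ### Rényi centers and capacities -/

section Capacity

variable {X Y : Type*} [Fintype X] [Fintype Y] {W : Matrix X Y ℝ}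

/-- The sum `∑ y, (∑ x, P x * W x y ^ a) ^ (1 / a)` inside the logarithm of the order-`a` Rényi
information. -/
noncomputable def renyiSum (a : ℝ) (P : X → ℝ) (W : Matrix X Y ℝ) : ℝ :=
  ∑ y, (∑ x, P x * W x y ^ a) ^ (1 / a)

lemma renyiInformation_eq {a : ℝ} (ha : a < 1) (P : X → ℝ) :
    renyiInformation a P W = a / (a - 1) * Real.log (renyiSum a P W) := by
  rw [renyiInformation, if_neg ha.ne, renyiSum]

lemma sum_mul_rpow_nonneg (hW : IsStochasticMatrix W) {P : X → ℝ} (hP : P ∈ stdSimplex ℝ X)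
    (a : ℝ) (y : Y) : 0 ≤ ∑ x, P x * W x y ^ a :=
  sum_nonneg fun x _ => mul_nonneg (hP.1 x) (Real.rpow_nonneg ((hW x).1 y) _)

lemma one_le_sum_mul_rpow (hW : IsStochasticMatrix W) {P : X → ℝ} (hP : P ∈ stdSimplex ℝ X)
    {a : ℝ} (ha0 : 0 < a) (ha1 : a < 1) : 1 ≤ ∑ y, ∑ x, P x * W x y ^ a := by
  rw [sum_comm]
  simp_rw [← mul_sum]
  calc (1 : ℝ) = ∑ x, P x * 1 := by simp [hP.2]
    _ ≤ _ := by
      refine sum_le_sum fun x _ => mul_le_mul_of_nonneg_left ?_ (hP.1 x)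
      rw [← (hW x).2]
      refine sum_le_sum fun y _ => ?_
      have hy1 : W x y ≤ 1 := by
        rw [← (hW x).2]
        exact single_le_sum (fun y _ => (hW x).1 y) (mem_univ y)
      rcases ((hW x).1 y).eq_or_lt with h | h
      · rw [← h, Real.zero_rpow ha0.ne']
      · calc W x y = W x y ^ (1 : ℝ) := (Real.rpow_one _).symm
          _ ≤ _ := Real.rpow_le_rpow_of_exponent_ge h hy1 ha1.le

/-- Hölder's inequality: every output distribution `q` bounds the order-`a` Rényi information by
the Rényi divergences of the rows from `q`. -/
lemma sum_mul_rpow_le_renyiSum_rpow (hW : IsStochasticMatrix W) {P : X → ℝ}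
    (hP : P ∈ stdSimplex ℝ X) {a : ℝ} (ha0 : 0 < a) (ha1 : a < 1) {q : Y → ℝ}
    (hq : ∀ y, 0 ≤ q y) (hq1 : ∑ y, q y = 1) :
    ∑ x, P x * hellinger (W x) q a ≤ renyiSum a P W ^ a := by
  have h1a : 0 < 1 - a := by linarith
  have hconj : (1 / a).HolderConjugate (1 / (1 - a)) := by
    rw [Real.holderConjugate_iff]
    refine ⟨by rw [lt_div_iff₀ ha0]; linarith, by simp⟩
  have := Real.inner_le_Lp_mul_Lq_of_nonneg univ hconj
    (f := fun y => ∑ x, P x * W x y ^ a) (g := fun y => q y ^ (1 - a))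
    (fun y _ => sum_mul_rpow_nonneg hW hP a y) (fun y _ => Real.rpow_nonneg (hq y) _)
  have e : ∀ y, (q y ^ (1 - a)) ^ (1 / (1 - a)) = q y := by
    intro y
    rw [← Real.rpow_mul (hq y), mul_one_div_cancel h1a.ne', Real.rpow_one]
  simp only [e, hq1, Real.one_rpow, mul_one, one_div_one_div] at this
  refine le_trans (le_of_eq ?_) this
  simp only [hellinger, mul_sum, sum_mul]
  rw [sum_comm]
  exact sum_congr rfl fun y _ => sum_congr rfl fun x _ => by ring

lemma renyiSum_pos (hW : IsStochasticMatrix W) {P : X → ℝ} (hP : P ∈ stdSimplex ℝ X)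
    {a : ℝ} (ha0 : 0 < a) (ha1 : a < 1) : 0 < renyiSum a P W := by
  have h1 := one_le_sum_mul_rpow hW hP ha0 ha1
  have hex : ∃ y ∈ (univ : Finset Y), 0 < ∑ x, P x * W x y ^ a := by
    apply exists_lt_of_sum_lt
    simpa using lt_of_lt_of_le one_pos h1
  obtain ⟨y, -, hy⟩ := hex
  exact sum_pos' (fun z _ => Real.rpow_nonneg (sum_mul_rpow_nonneg hW hP a z) _)
    ⟨y, mem_univ y, Real.rpow_pos_of_pos hy _⟩

lemma renyiInformation_le_of_le_hellinger (hW : IsStochasticMatrix W) {P : X → ℝ}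
    (hP : P ∈ stdSimplex ℝ X) {a : ℝ} (ha0 : 0 < a) (ha1 : a < 1) {q : Y → ℝ}
    (hq : ∀ y, 0 ≤ q y) (hq1 : ∑ y, q y = 1) {D : ℝ}
    (hD : ∀ x, Real.exp (-((1 - a) * D)) ≤ hellinger (W x) q a) :
    renyiInformation a P W ≤ D := by
  have h := sum_mul_rpow_le_renyiSum_rpow hW hP ha0 ha1 hq hq1
  have h1 : Real.exp (-((1 - a) * D)) ≤ renyiSum a P W ^ a := by
    refine le_trans ?_ h
    calc Real.exp (-((1 - a) * D)) = ∑ x, P x * Real.exp (-((1 - a) * D)) := by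
          rw [← sum_mul, hP.2, one_mul]
      _ ≤ _ := sum_le_sum fun x _ => mul_le_mul_of_nonneg_left (hD x) (hP.1 x)
  have hpos := renyiSum_pos hW hP ha0 ha1
  have h2 := Real.log_le_log (Real.exp_pos _) h1
  rw [Real.log_exp, Real.log_rpow hpos] at h2
  rw [renyiInformation_eq ha1]
  have h1a : 0 < 1 - a := by linarith
  have e : a / (a - 1) * Real.log (renyiSum a P W) =
      -(a * Real.log (renyiSum a P W)) / (1 - a) := by
    rw [← neg_sub 1 a]
    field_simp
  rw [e, div_le_iff₀ h1a]
  linarith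

lemma renyiInformation_nonneg (hW : IsStochasticMatrix W) {P : X → ℝ} (hP : P ∈ stdSimplex ℝ X)
    {a : ℝ} (ha0 : 0 < a) (ha1 : a < 1) : 0 ≤ renyiInformation a P W := by
  rw [renyiInformation_eq ha1]
  have h : renyiSum a P W ≤ 1 := by
    have hp : 1 ≤ 1 / a := by rw [le_div_iff₀ ha0]; linarith
    calc renyiSum a P W ≤ ∑ y, ∑ x, P x * W x y := by
          refine sum_le_sum fun y _ => ?_
          refine (Real.rpow_arith_mean_le_arith_mean_rpow univ P (fun x => W x y ^ a)
            (fun x _ => hP.1 x) hP.2 (fun x _ => Real.rpow_nonneg ((hW x).1 y) _) hp).trans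
            (le_of_eq (sum_congr rfl fun x _ => ?_))
          rw [← Real.rpow_mul ((hW x).1 y), mul_one_div_cancel ha0.ne', Real.rpow_one]
      _ = 1 := by
          rw [sum_comm]
          simp_rw [← mul_sum]
          simp [fun x => (hW x).2, hP.2]
  exact mul_nonneg_of_nonpos_of_nonpos (div_nonpos_of_nonneg_of_nonpos ha0.le (by linarith))
    (Real.log_nonpos (renyiSum_pos hW hP ha0 ha1).le h)

lemma renyiInformation_le_log_card [Nonempty Y] (hW : IsStochasticMatrix W) {P : X → ℝ}
    (hP : P ∈ stdSimplex ℝ X) {a : ℝ} (ha0 : 0 < a) (ha1 : a < 1) :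
    renyiInformation a P W ≤ Real.log (Fintype.card Y) := by
  have hc : (0 : ℝ) < Fintype.card Y := by exact_mod_cast Fintype.card_pos
  refine renyiInformation_le_of_le_hellinger hW hP ha0 ha1
    (q := fun _ => (Fintype.card Y : ℝ)⁻¹) (fun y => by positivity) (by simp [hc.ne']) fun x => ?_
  have h1 : 1 ≤ ∑ y, W x y ^ a := by
    classical
    have := one_le_sum_mul_rpow hW (P := Pi.single x 1) (single_mem_stdSimplex ℝ x) ha0 ha1
    simpa [Pi.single_apply] using this
  calc Real.exp (-((1 - a) * Real.log (Fintype.card Y)))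
      = 1 * ((Fintype.card Y : ℝ)⁻¹) ^ (1 - a) := by
        rw [Real.rpow_def_of_pos (by positivity), Real.log_inv, one_mul]
        ring_nf
    _ ≤ (∑ y, W x y ^ a) * ((Fintype.card Y : ℝ)⁻¹) ^ (1 - a) := by gcongr
    _ = _ := by rw [hellinger, sum_mul]

lemma renyiCapacity_nonneg (hW : IsStochasticMatrix W) {a : ℝ} (ha0 : 0 < a) (ha1 : a < 1) :
    0 ≤ renyiCapacity a W := by
  refine Real.sSup_nonneg ?_
  rintro _ ⟨P, hP, rfl⟩
  exact renyiInformation_nonneg hW hP ha0 ha1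

lemma renyiCapacity_le_log_card [Nonempty Y] (hW : IsStochasticMatrix W) {a : ℝ}
    (ha0 : 0 < a) (ha1 : a < 1) : renyiCapacity a W ≤ Real.log (Fintype.card Y) := by
  refine Real.sSup_le ?_ (Real.log_natCast_nonneg _)
  rintro _ ⟨P, hP, rfl⟩
  exact renyiInformation_le_log_card hW hP ha0 ha1

/-- Existence of the order-`a` Rényi center: an output distribution whose order-`a` Rényi
divergence from every row of `W` is at most the order-`a` capacity. It is the normalization of
`(∑ x, P x * W x y ^ a) ^ (1 / a)` for a prior `P` minimizing `renyiSum`, and the bound is the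
first-order optimality condition at `P` in the direction of a point mass. -/
lemma exists_renyiCenter [Nonempty X] [Nonempty Y] (hW : IsStochasticMatrix W) {a : ℝ}
    (ha0 : 0 < a) (ha1 : a < 1) :
    ∃ q ∈ stdSimplex ℝ Y, ∀ x,
      Real.exp (-((1 - a) * renyiCapacity a W)) ≤ hellinger (W x) q a := by
  classical
  have hp : 1 < 1 / a := by rw [lt_div_iff₀ ha0]; linarith
  have hcont : Continuous fun P : X → ℝ => renyiSum a P W := by
    unfold renyiSum
    refine continuous_finsetSum _ fun y _ => Continuous.rpow_const (by fun_prop) fun P => ?_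
    right; positivity
  obtain ⟨P, hP, hmin⟩ := (isCompact_stdSimplex ℝ X).exists_isMinOn
    ⟨_, single_mem_stdSimplex ℝ (Classical.arbitrary X)⟩ hcont.continuousOn
  set F := renyiSum a P W with hF
  have hFpos : 0 < F := renyiSum_pos hW hP ha0 ha1
  set S : Y → ℝ := fun y => ∑ x, P x * W x y ^ a with hS
  have hS0 : ∀ y, 0 ≤ S y := sum_mul_rpow_nonneg hW hP a
  have hFC : F ^ a = Real.exp (-((1 - a) * renyiInformation a P W)) := by
    rw [renyiInformation_eq ha1, Real.rpow_def_of_pos hFpos]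
    congr 1
    have : a - 1 ≠ 0 := by linarith
    field_simp
    ring
  have hIC : renyiInformation a P W ≤ renyiCapacity a W :=
    le_csSup ⟨Real.log (Fintype.card Y), by
      rintro _ ⟨P', hP', rfl⟩
      exact renyiInformation_le_log_card hW hP' ha0 ha1⟩ ⟨P, hP, rfl⟩
  -- the first-order condition at `P` in the direction of the point mass at `x`
  have kkt : ∀ x, F ≤ ∑ y, W x y ^ a * S y ^ (1 / a - 1) := by
    intro x
    set φ : ℝ → ℝ := fun t => ∑ y, (S y + t * (W x y ^ a - S y)) ^ (1 / a) with hφ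
    have hφ' : HasDerivAt φ
        (∑ y, 1 / a * (S y) ^ (1 / a - 1) * (W x y ^ a - S y)) 0 := by
      refine HasDerivAt.fun_sum fun y _ => ?_
      have h1 : HasDerivAt (fun t : ℝ => S y + t * (W x y ^ a - S y)) (W x y ^ a - S y) 0 := by
        simpa using ((hasDerivAt_id (0 : ℝ)).mul_const (W x y ^ a - S y)).const_add (S y)
      have h2 := h1.rpow_const (p := 1 / a) (Or.inr hp.le)
      rw [zero_mul, add_zero] at h2
      have e : 1 / a * S y ^ (1 / a - 1) * (W x y ^ a - S y) =
          (W x y ^ a - S y) * (1 / a) * S y ^ (1 / a - 1) := by ring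
      rw [e]
      exact h2
    have hφmin : ∀ t ∈ Set.Icc (0 : ℝ) 1, φ 0 ≤ φ t := by
      intro t ht
      have hmem : (1 - t) • P + t • Pi.single x (1 : ℝ) ∈ stdSimplex ℝ X :=
        convex_stdSimplex ℝ X hP (single_mem_stdSimplex ℝ x) (by linarith [ht.2]) ht.1 (by ring)
      have h1 : F ≤ renyiSum a ((1 - t) • P + t • Pi.single x (1 : ℝ)) W := hmin hmem
      have e0 : φ 0 = F := by simp [hφ, hF, renyiSum, hS]
      have e1 : renyiSum a ((1 - t) • P + t • Pi.single x (1 : ℝ)) W = φ t := by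
        refine sum_congr rfl fun y _ => ?_
        congr 1
        simp only [Pi.add_apply, Pi.smul_apply, smul_eq_mul, add_mul, sum_add_distrib, mul_assoc,
          ← mul_sum, Pi.single_apply, ite_mul, one_mul, zero_mul, sum_ite_eq', mem_univ, if_true]
        simp only [hS]
        ring
      rw [e0, ← e1]; exact h1
    have hd : 0 ≤ ∑ y, 1 / a * (S y) ^ (1 / a - 1) * (W x y ^ a - S y) := by
      have hlim := (hasDerivAt_iff_tendsto_slope.1 hφ').mono_left
        (nhdsWithin_mono 0 (fun t (ht : t ∈ Set.Ioi (0 : ℝ)) => ne_of_gt ht))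
      refine ge_of_tendsto hlim ?_
      filter_upwards [Ioo_mem_nhdsGT (zero_lt_one' ℝ)] with t ht
      rw [slope_def_field]
      exact div_nonneg (sub_nonneg.2 (hφmin t ⟨ht.1.le, ht.2.le⟩)) (by linarith [ht.1])
    have e : ∑ y, 1 / a * (S y) ^ (1 / a - 1) * (W x y ^ a - S y) =
        1 / a * (∑ y, W x y ^ a * S y ^ (1 / a - 1) - F) := by
      rw [hF, renyiSum, ← sum_sub_distrib, mul_sum]
      refine sum_congr rfl fun y _ => ?_
      have : (∑ x, P x * W x y ^ a) ^ (1 / a) = S y ^ (1 / a - 1) * S y := by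
        change S y ^ (1 / a) = _
        rcases (hS0 y).eq_or_lt with h | h
        · rw [← h, Real.zero_rpow (by positivity)]; simp
        · rw [Real.rpow_sub_one h.ne']; field_simp
      rw [this]; ring
    rw [e] at hd
    by_contra! hc
    have : 1 / a * (∑ y, W x y ^ a * S y ^ (1 / a - 1) - F) < 0 :=
      mul_neg_of_pos_of_neg (by positivity) (by linarith)
    linarith
  refine ⟨fun y => S y ^ (1 / a) / F, ⟨fun y => div_nonneg (Real.rpow_nonneg (hS0 y) _) hFpos.le,
    ?_⟩, fun x => ?_⟩
  · rw [← sum_div]; exact div_self hFpos.ne'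
  · have e : hellinger (W x) (fun y => S y ^ (1 / a) / F) a =
        (∑ y, W x y ^ a * S y ^ (1 / a - 1)) / F ^ (1 - a) := by
      rw [hellinger, sum_div]
      refine sum_congr rfl fun y _ => ?_
      rw [Real.div_rpow (Real.rpow_nonneg (hS0 y) _) hFpos.le, ← Real.rpow_mul (hS0 y),
        mul_div_assoc]
      congr 3
      field_simp
    calc Real.exp (-((1 - a) * renyiCapacity a W))
        ≤ Real.exp (-((1 - a) * renyiInformation a P W)) := by
          apply Real.exp_le_exp.2
          nlinarith
      _ = F / F ^ (1 - a) := by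
          rw [← hFC, Real.rpow_sub hFpos, Real.rpow_one]
          have := Real.rpow_pos_of_pos hFpos a
          field_simp
      _ ≤ _ := by
          rw [e]
          have := Real.rpow_pos_of_pos hFpos (1 - a)
          gcongr
          exact kkt x

lemma renyiCapacity_mono [Nonempty X] [Nonempty Y] (hW : IsStochasticMatrix W) {a b : ℝ}
    (ha : 0 < a) (hab : a ≤ b) (hb : b < 1) : renyiCapacity a W ≤ renyiCapacity b W := by
  obtain ⟨q, hq, hqW⟩ := exists_renyiCenter hW (ha.trans_le hab) hb
  refine Real.sSup_le ?_ (renyiCapacity_nonneg hW (ha.trans_le hab) hb)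
  rintro _ ⟨P, hP, rfl⟩
  exact renyiInformation_le_of_le_hellinger hW hP ha (hab.trans_lt hb) hq.1 hq.2
    fun x => exp_neg_le_hellinger_of_le (hW x) hq.1 ha hab hb (hqW x)

/-- The limit defining the order-`0` capacity exists, so the capacities of small orders are
eventually below any number above it. -/
lemma exists_renyiCapacity_lt [Nonempty X] [Nonempty Y] (hW : IsStochasticMatrix W) {R : ℝ}
    (hR : renyiCapacityZero W < R) :
    ∃ a ∈ Set.Ioo (0 : ℝ) 1, ∀ b, 0 < b → b ≤ a → renyiCapacity b W < R := by
  -- cut off at order `1 / 2`, to have a function that is monotone on all of `(0, ∞)`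
  set g : ℝ → ℝ := fun a => renyiCapacity (min a (1 / 2)) W with hg
  have hmono : MonotoneOn g (Set.Ioi 0) := by
    intro a ha b hb hab
    have : min b (1 / 2 : ℝ) ≤ 1 / 2 := min_le_right _ _
    exact renyiCapacity_mono hW (lt_min ha (by norm_num)) (min_le_min_right _ hab) (by linarith)
  have hbdd : BddBelow (g '' Set.Ioi 0) := by
    refine ⟨0, ?_⟩
    rintro _ ⟨a, ha, rfl⟩
    have : min a (1 / 2 : ℝ) ≤ 1 / 2 := min_le_right _ _
    exact renyiCapacity_nonneg hW (lt_min ha (by norm_num)) (by linarith)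
  have heq : g =ᶠ[nhdsWithin 0 (Set.Ioi 0)] fun a => renyiCapacity a W := by
    filter_upwards [Ioo_mem_nhdsGT (show (0 : ℝ) < 1 / 2 by norm_num)] with a ha
    simp only [hg, min_eq_left ha.2.le]
  have hlim := (hmono.tendsto_nhdsGT hbdd).congr' heq
  have hlt : sInf (g '' Set.Ioi 0) < R := by
    rw [← hlim.limUnder_eq]; exact hR
  obtain ⟨a, ha, ha1⟩ := ((hlim.eventually (eventually_lt_nhds hlt)).and
    (Ioo_mem_nhdsGT (zero_lt_one' ℝ))).exists
  exact ⟨a, ha1, fun b hb hba => (renyiCapacity_mono hW hb hba ha1.2).trans_lt ha⟩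

end Capacity

/-! ### Channels with feedback and concatenation of blocks -/

section Feedback

variable {X Y : Type*}

/-- The probability of the output sequence `y` when the input at each time is chosen by the
strategy `s` from the list of all earlier outputs. Unlike `FeedbackInput`, the type of strategies
does not depend on the length, which lets a strategy be continued after an initial block. -/
noncomputable def strategyProb (W : Matrix X Y ℝ) (n : ℕ) (s : List Y → X) (y : Fin n → Y) : ℝ :=
  ∏ t : Fin n, W (s (List.ofFn (pastOutputs y t))) (y t)

lemma exists_strategyProb_eq [Nonempty X] (W : Matrix X Y ℝ) {n : ℕ} (x : FeedbackInput X Y n) :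
    ∃ s : List Y → X, ∀ y, feedbackChannel (fun _ => W) x y = strategyProb W n s y := by
  classical
  refine ⟨fun l => if h : l.length < n then x ⟨l.length, h⟩ l.get else Classical.arbitrary X,
    fun y => prod_congr rfl fun t _ => ?_⟩
  have key : ∀ (k : ℕ) (hk : k < n) (f : Fin k → Y),
      (if h : (List.ofFn f).length < n then x ⟨(List.ofFn f).length, h⟩ (List.ofFn f).get
        else Classical.arbitrary X) = x ⟨k, hk⟩ f := by
    intro k hk f
    have gen : ∀ (l : List Y) (hl : l.length = k), (∀ i : Fin k, l.get (i.cast hl.symm) = f i) →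
        (if h : l.length < n then x ⟨l.length, h⟩ l.get else Classical.arbitrary X) =
          x ⟨k, hk⟩ f := by
      intro l hl hf
      subst hl
      rw [dif_pos hk]
      congr 1
      funext i
      exact hf i
    exact gen _ (List.length_ofFn) fun i => by simp
  simp only [key t t.2 (pastOutputs y t)]

lemma strategyProb_append (W : Matrix X Y ℝ) (m n : ℕ) (s : List Y → X) (a : Fin m → Y)
    (b : Fin n → Y) :
    strategyProb W (m + n) s (Fin.append a b) =
      strategyProb W m s a * strategyProb W n (fun l => s (List.ofFn a ++ l)) b := by
  unfold strategyProb
  rw [Fin.prod_univ_add]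
  congr 1
  · refine prod_congr rfl fun t _ => ?_
    have h : pastOutputs (Fin.append a b) (Fin.castAdd n t) = pastOutputs a t := by
      funext i
      exact Fin.append_left a b (Fin.castLE t.isLt.le i)
    rw [h, Fin.append_left]
  · refine prod_congr rfl fun t _ => ?_
    have h : pastOutputs (Fin.append a b) (Fin.natAdd m t) = Fin.append a (pastOutputs b t) := by
      funext i
      refine Fin.addCases (fun j => ?_) (fun j => ?_) i
      · exact (Fin.append_left a b j).trans (Fin.append_left a _ j).symm
      · exact (Fin.append_right a b (Fin.castLE t.isLt.le j)).trans
          (Fin.append_right a (pastOutputs b t) j).symm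
    have e : List.ofFn (pastOutputs (Fin.append a b) (Fin.natAdd m t)) =
        List.ofFn a ++ List.ofFn (pastOutputs b t) :=
      (congrArg List.ofFn h).trans (List.ofFn_fin_append _ _)
    rw [Fin.append_right, e]

lemma sum_append [Fintype Y] (m n : ℕ) (F : (Fin (m + n) → Y) → ℝ) :
    ∑ y, F y = ∑ a : Fin m → Y, ∑ b : Fin n → Y, F (Fin.append a b) := by
  rw [← (Fin.appendEquiv m n).sum_comp, Fintype.sum_prod_type]
  rfl

lemma sum_fin_one [Fintype Y] (F : Y → ℝ) : ∑ b : Fin 1 → Y, F (b 0) = ∑ y, F y :=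
  (Equiv.funUnique (Fin 1) Y).sum_comp F

lemma strategyProb_one (W : Matrix X Y ℝ) (s : List Y → X) (b : Fin 1 → Y) :
    strategyProb W 1 s b = W (s []) (b 0) := by
  simp [strategyProb]

variable [Fintype Y] {W : Matrix X Y ℝ}

lemma strategyProb_mem_stdSimplex (hW : IsStochasticMatrix W) (n : ℕ) (s : List Y → X) :
    strategyProb W n s ∈ stdSimplex ℝ (Fin n → Y) := by
  refine ⟨fun y => prod_nonneg fun t _ => (hW _).1 _, ?_⟩
  induction n with
  | zero => simp [strategyProb]
  | succ n ih =>
    rw [sum_append]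
    simp only [strategyProb_append, strategyProb_one, ← mul_sum, sum_fin_one, (hW _).2, mul_one, ih]

/-- The Rényi divergence between a feedback channel output and a product distribution is at most
the sum of the single-letter bounds. -/
lemma le_hellinger_strategyProb (hW : IsStochasticMatrix W) {q : Y → ℝ} (hq : ∀ y, 0 ≤ q y)
    {a C : ℝ} (hC : ∀ x, Real.exp (-((1 - a) * C)) ≤ hellinger (W x) q a) (n : ℕ)
    (s : List Y → X) :
    Real.exp (-((1 - a) * (n * C))) ≤
      hellinger (strategyProb W n s) (fun y => ∏ t, q (y t)) a := by
  induction n with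
  | zero => simp [hellinger, strategyProb]
  | succ n ih =>
    have hQ : ∀ y : Fin n → Y, 0 ≤ ∏ t, q (y t) := fun y => prod_nonneg fun t _ => hq _
    have hw : ∀ y, 0 ≤ strategyProb W n s y := (strategyProb_mem_stdSimplex hW n s).1
    have e : ∀ (x : Fin n → Y) (b : Fin 1 → Y),
        strategyProb W (n + 1) s (Fin.append x b) ^ a *
          (∏ t, q (Fin.append x b t)) ^ (1 - a) =
        (strategyProb W n s x ^ a * (∏ t, q (x t)) ^ (1 - a)) *
          (W (s (List.ofFn x)) (b 0) ^ a * q (b 0) ^ (1 - a)) := by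
      intro x b
      rw [strategyProb_append, strategyProb_one, Fin.prod_univ_add]
      simp only [Fin.append_left, Fin.append_right, Fin.prod_univ_one, List.append_nil]
      rw [Real.mul_rpow (hw x) ((hW _).1 _), Real.mul_rpow (hQ x) (hq _)]
      ring
    rw [hellinger, sum_append]
    simp only [e, ← mul_sum]
    calc Real.exp (-((1 - a) * ((n + 1 : ℕ) * C)))
        = Real.exp (-((1 - a) * (n * C))) * Real.exp (-((1 - a) * C)) := by
          rw [← Real.exp_add]; push_cast; ring_nf
      _ ≤ hellinger (strategyProb W n s) (fun y => ∏ t, q (y t)) a *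
            Real.exp (-((1 - a) * C)) := by gcongr
      _ ≤ _ := by
          rw [hellinger, sum_mul]
          refine sum_le_sum fun x _ => mul_le_mul_of_nonneg_left ?_
            (mul_nonneg (Real.rpow_nonneg (hw x) _) (Real.rpow_nonneg (hQ x) _))
          rw [sum_fin_one (fun y => W (s (List.ofFn x)) y ^ a * q y ^ (1 - a))]
          exact hC _

/-- The length-`n` feedback channel has a reference output distribution `Q`, not depending on the
strategy, and for every strategy an auxiliary output distribution `V`, such that the order-`l`
moments of the likelihood ratios of `V` to `Q` and of `V` to the channel output are at most `A`
and `B`. The auxiliary distribution vanishes where the channel output does, so that no division by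
zero hides an infinite likelihood ratio. -/
def MomentBound (W : Matrix X Y ℝ) (l : ℝ) (n : ℕ) (A B : ℝ) : Prop :=
  ∃ Q : (Fin n → Y) → ℝ, (∀ y, 0 < Q y) ∧ ∑ y, Q y = 1 ∧
    ∀ s : List Y → X, ∃ V ∈ stdSimplex ℝ (Fin n → Y),
      (∀ y, strategyProb W n s y = 0 → V y = 0) ∧
      ∑ y, V y * (V y / Q y) ^ l ≤ A ∧ ∑ y, V y * (V y / strategyProb W n s y) ^ l ≤ B

/-- Moment bounds multiply under concatenation of blocks: the auxiliary distribution of the second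
block is chosen given the outputs of the first one. -/
lemma MomentBound.append (hW : IsStochasticMatrix W) {l : ℝ} {m n : ℕ} {A B A' B' : ℝ}
    (hA' : 0 ≤ A') (hB' : 0 ≤ B')
    (h : MomentBound W l m A B) (h' : MomentBound W l n A' B') :
    MomentBound W l (m + n) (A * A') (B * B') := by
  obtain ⟨Q, hQ, hQ1, H⟩ := h
  obtain ⟨Q', hQ', hQ1', H'⟩ := h'
  refine ⟨fun y => Q (fun i => y (Fin.castAdd n i)) * Q' (fun i => y (Fin.natAdd m i)),
    fun y => mul_pos (hQ _) (hQ' _), ?_, fun s => ?_⟩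
  · rw [sum_append]
    simp only [Fin.append_left, Fin.append_right, ← mul_sum, hQ1', mul_one, hQ1]
  obtain ⟨V, hV, hV0, hVA, hVB⟩ := H s
  choose V' hV' hV0' hVA' hVB' using fun a : Fin m → Y => H' (fun l => s (List.ofFn a ++ l))
  have key : ∀ (R : (Fin m → Y) → ℝ) (R' : (Fin m → Y) → (Fin n → Y) → ℝ) (C C' : ℝ),
      (∀ a, 0 ≤ R a) → (∀ a b, 0 ≤ R' a b) → 0 ≤ C' → ∑ a, V a * (V a / R a) ^ l ≤ C →
      (∀ a, ∑ b, V' a b * (V' a b / R' a b) ^ l ≤ C') →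
      ∑ a, ∑ b, V a * V' a b * (V a * V' a b / (R a * R' a b)) ^ l ≤ C * C' := by
    intro R R' C C' hR hR' hC' h1 h2
    have e : ∀ a b, V a * V' a b * (V a * V' a b / (R a * R' a b)) ^ l =
        (V a * (V a / R a) ^ l) * (V' a b * (V' a b / R' a b) ^ l) := by
      intro a b
      rw [mul_div_mul_comm, Real.mul_rpow (div_nonneg (hV.1 a) (hR a))
        (div_nonneg ((hV' a).1 b) (hR' a b))]
      ring
    simp only [e, ← mul_sum]
    calc _ ≤ ∑ a, (V a * (V a / R a) ^ l) * C' := by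
          refine sum_le_sum fun a _ => mul_le_mul_of_nonneg_left (h2 a) ?_
          exact mul_nonneg (hV.1 a) (Real.rpow_nonneg (div_nonneg (hV.1 a) (hR a)) _)
      _ ≤ C * C' := by
          rw [← sum_mul]
          exact mul_le_mul_of_nonneg_right h1 hC'
  have split : ∀ y : Fin (m + n) → Y,
      Fin.append (fun i => y (Fin.castAdd n i)) (fun i => y (Fin.natAdd m i)) = y :=
    fun y => (Fin.appendEquiv m n).right_inv y
  refine ⟨fun y => V (fun i => y (Fin.castAdd n i)) *
    V' (fun i => y (Fin.castAdd n i)) (fun i => y (Fin.natAdd m i)),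
    ⟨fun y => mul_nonneg (hV.1 _) ((hV' _).1 _), ?_⟩, fun y hy => ?_, ?_, ?_⟩
  · rw [sum_append]
    simp only [Fin.append_left, Fin.append_right, ← mul_sum, (hV' _).2, mul_one, hV.2]
  · rw [← split y, strategyProb_append, mul_eq_zero] at hy
    beta_reduce
    rcases hy with hy | hy
    · rw [hV0 _ hy, zero_mul]
    · rw [hV0' _ _ hy, mul_zero]
  · rw [sum_append]
    simp only [Fin.append_left, Fin.append_right]
    exact key Q (fun _ => Q') A A' (fun a => (hQ a).le) (fun _ b => (hQ' b).le) hA' hVA hVA'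
  · rw [sum_append]
    simp only [Fin.append_left, Fin.append_right, strategyProb_append]
    exact key _ (fun a => strategyProb W n (fun l => s (List.ofFn a ++ l))) B B'
      (strategyProb_mem_stdSimplex hW m s).1
      (fun a => (strategyProb_mem_stdSimplex hW n _).1) hB' hVB hVB'

/-- The moment bound of an arbitrary length, cut into blocks of length `N` and a remainder. -/
lemma MomentBound.of_blocks (hW : IsStochasticMatrix W) {l a b c d : ℝ} {N : ℕ} (hN : 0 < N)
    (h : ∀ n ≤ N, MomentBound W l n (Real.exp (n * a + c)) (Real.exp (n * b + d))) (n : ℕ) :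
    MomentBound W l n (Real.exp (n * a + ((n / N : ℕ) + 1) * c))
      (Real.exp (n * b + ((n / N : ℕ) + 1) * d)) := by
  have main : ∀ k r : ℕ, r ≤ N →
      MomentBound W l (r + N * k) (Real.exp ((r + N * k : ℕ) * a + (k + 1) * c))
        (Real.exp ((r + N * k : ℕ) * b + (k + 1) * d)) := by
    intro k r hr
    induction k with
    | zero => simpa using h r hr
    | succ k ih =>
      have := ih.append hW (Real.exp_pos _).le (Real.exp_pos _).le (h N le_rfl)
      rw [← Real.exp_add, ← Real.exp_add] at this
      have e : ∀ x z : ℝ, ((r + N * k : ℕ) * x + (k + 1) * z) + (N * x + z) =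
          (r + N * (k + 1) : ℕ) * x + ((k + 1 : ℕ) + 1) * z := by
        intro x z; push_cast; ring
      rw [e, e, add_assoc r, ← Nat.mul_succ] at this
      exact this
  have := main (n / N) (n % N) (Nat.mod_lt n hN).le
  rwa [Nat.mod_add_div] at this

end Feedback

/-! ### The moment bound of a single block -/

section Block

variable {X Y : Type*} [Fintype X] [Fintype Y] {W : Matrix X Y ℝ}

/-- Augustin's averaging: one reference distribution on blocks of length `n` works for all orders
`s ∈ (0, 1 - 1 / N]` at once, at the cost `log N`. It is the average of the uniform distribution
and of the products of the Rényi centers of the orders `k / N`, `0 < k < N`; an order `s` is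
rounded up to such a `k / N`. -/
lemma exists_averaged_center [Nonempty X] [Nonempty Y] (hW : IsStochasticMatrix W) {N : ℕ}
    (hN : 0 < N) (n : ℕ) :
    ∃ Q : (Fin n → Y) → ℝ, (∀ y, 0 < Q y) ∧ ∑ y, Q y = 1 ∧
      ∀ s : ℝ, 0 < s → s ≤ 1 - 1 / N → ∃ b, s ≤ b ∧ b ≤ s + 1 / N ∧ b < 1 ∧
        ∀ σ : List Y → X, -Real.log (hellinger (strategyProb W n σ) Q s) ≤
          (1 - s) * (n * renyiCapacity b W + Real.log N) := by
  have hNR : (0 : ℝ) < N := by exact_mod_cast hN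
  have hcY : (0 : ℝ) < Fintype.card Y := by exact_mod_cast Fintype.card_pos
  have hex : ∀ k : ℕ, ∃ q ∈ stdSimplex ℝ Y, (k = 0 → ∀ y, 0 < q y) ∧
      (0 < k → k < N → ∀ x, Real.exp (-((1 - (k / N : ℝ)) * renyiCapacity (k / N : ℝ) W)) ≤
        hellinger (W x) q (k / N : ℝ)) := by
    intro k
    by_cases hk : 0 < k ∧ k < N
    · have h0 : (0 : ℝ) < k / N := div_pos (by exact_mod_cast hk.1) hNR
      have h1 : (k / N : ℝ) < 1 := by rw [div_lt_one hNR]; exact_mod_cast hk.2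
      obtain ⟨q, hq, hqW⟩ := exists_renyiCenter hW h0 h1
      exact ⟨q, hq, fun h => absurd h hk.1.ne', fun _ _ => hqW⟩
    · refine ⟨fun _ => (Fintype.card Y : ℝ)⁻¹, ⟨fun _ => by positivity, by simp [hcY.ne']⟩,
        fun _ _ => by positivity, fun h h' => absurd ⟨h, h'⟩ hk⟩
  choose q hq hq0 hqW using hex
  have hp : ∀ k (y : Fin n → Y), 0 ≤ ∏ t, q k (y t) := fun k y =>
    prod_nonneg fun t _ => (hq k).1 _
  set Q : (Fin n → Y) → ℝ := fun y => (N : ℝ)⁻¹ * ∑ k ∈ range N, ∏ t, q k (y t) with hQ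
  have hQpos : ∀ y, 0 < Q y := by
    intro y
    refine mul_pos (by positivity) (sum_pos' (fun k _ => hp k y) ⟨0, by simpa using hN, ?_⟩)
    exact prod_pos fun t _ => hq0 0 rfl _
  refine ⟨Q, hQpos, ?_, fun s hs0 hs1 => ?_⟩
  · have e : ∀ k, ∑ y : Fin n → Y, ∏ t, q k (y t) = 1 := by
      classical
      intro k
      have := Finset.prod_univ_sum (fun _ : Fin n => (univ : Finset Y)) (fun _ j => q k j)
      rw [Fintype.piFinset_univ] at this
      rw [← this, (hq k).2, prod_const_one]
    rw [hQ, ← mul_sum, sum_comm]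
    simp [e, hNR.ne']
  · set k := ⌈s * N⌉₊ with hk
    have hsN : 0 < s * N := by positivity
    have hk0 : 0 < k := Nat.ceil_pos.2 hsN
    have hk1 : s * N ≤ k := Nat.le_ceil _
    have hk2 : (k : ℝ) < s * N + 1 := Nat.ceil_lt_add_one hsN.le
    have hkN : k < N := by
      have h1 : s * N ≤ N - 1 := by
        calc s * N ≤ (1 - 1 / N) * N := by gcongr
          _ = N - 1 := by field_simp
      have h2 : (k : ℝ) < N := by linarith
      exact_mod_cast h2
    have hb1 : (k / N : ℝ) < 1 := by rw [div_lt_one hNR]; exact_mod_cast hkN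
    have hsb : s ≤ k / N := by rwa [le_div_iff₀ hNR]
    refine ⟨k / N, hsb, ?_, hb1, fun σ => ?_⟩
    · rw [div_le_iff₀ hNR, add_mul, one_div_mul_cancel hNR.ne']
      exact hk2.le
    · have hw := strategyProb_mem_stdSimplex hW n σ
      have h1 := le_hellinger_strategyProb hW (hq k).1 (hqW k hk0 hkN) n σ
      have h2 : Real.exp (-((1 - k / N) * (n * renyiCapacity (k / N) W + Real.log N))) ≤
          hellinger (strategyProb W n σ) Q (k / N) := by
        calc _ = Real.exp (-((1 - k / N) * (n * renyiCapacity (k / N) W))) *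
              ((N : ℝ)⁻¹) ^ (1 - k / N : ℝ) := by
              rw [Real.rpow_def_of_pos (by positivity), Real.log_inv, ← Real.exp_add]
              ring_nf
          _ ≤ hellinger (strategyProb W n σ) (fun y => ∏ t, q k (y t)) (k / N) *
              ((N : ℝ)⁻¹) ^ (1 - k / N : ℝ) := by gcongr
          _ ≤ _ := by
              rw [hellinger, hellinger, sum_mul]
              refine sum_le_sum fun y _ => ?_
              rw [mul_assoc, ← Real.mul_rpow (hp k y) (by positivity), mul_comm _ (N : ℝ)⁻¹]
              refine mul_le_mul_of_nonneg_left (Real.rpow_le_rpow ?_ ?_ (by linarith))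
                (Real.rpow_nonneg (hw.1 y) _)
              · exact mul_nonneg (by positivity) (hp k y)
              · refine mul_le_mul_of_nonneg_left ?_ (by positivity)
                exact single_le_sum (f := fun k => ∏ t, q k (y t)) (fun k _ => hp k y)
                  (mem_range.2 hkN)
      have h3 := exp_neg_le_hellinger_of_le hw (fun y => (hQpos y).le) hs0 hsb hb1 h2
      have := Real.log_le_log (Real.exp_pos _) h3
      rw [Real.log_exp] at this
      linarith

/-- The moment bound of a block of length `n ≤ N`. The relative entropy of the auxiliary
distribution from the reference distribution is at most `n * R + log N`, and that from the channel
output is at most `n * E` up to a constant. -/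
lemma momentBound_block [Nonempty X] [Nonempty Y] (hW : IsStochasticMatrix W) {N : ℕ}
    {a₀ R E l c : ℝ} (hN : 2 ≤ N) (ha0 : 0 < a₀) (haN : a₀ ≤ 1 - 1 / N)
    (hR : ∀ b, 0 < b → b ≤ a₀ + 1 / N → b < 1 → renyiCapacity b W ≤ R)
    (hE0 : 0 ≤ E) (hE : ∀ b, 0 < b → b < 1 → (1 - b) / b * (renyiCapacity b W - R) ≤ E)
    (hl0 : 0 ≤ l) (hl : l ≤ a₀ / (2 * N)) (hc : Real.log (Fintype.card Y) + 1 ≤ c)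
    {n : ℕ} (hn : n ≤ N) :
    MomentBound W l n (Real.exp (l * (n * R + Real.log N) + 16 * Real.exp c * (l * N / a₀) ^ 2))
      (Real.exp (l * (n * E + 2 * c / a₀ ^ 2) + 16 * Real.exp c * (l * N / a₀) ^ 2)) := by
  have hNR : (2 : ℝ) ≤ N := by exact_mod_cast hN
  have hnN : (n : ℝ) ≤ N := by exact_mod_cast hn
  have hn0 : (0 : ℝ) ≤ n := n.cast_nonneg
  have hlY : 0 ≤ Real.log (Fintype.card Y) := Real.log_natCast_nonneg _
  have hlN : 0 ≤ Real.log N := Real.log_natCast_nonneg _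
  have hlN' : Real.log N ≤ N := (Real.log_le_sub_one_of_pos (by linarith)).trans (by linarith)
  have hc1 : 1 ≤ c := by linarith
  have hinv : 1 / (N : ℝ) ≤ 1 / 2 := one_div_le_one_div_of_le two_pos hNR
  have hinv0 : 0 < 1 / (N : ℝ) := by positivity
  have ha1 : a₀ < 1 := by linarith
  obtain ⟨Q, hQ, hQ1, H⟩ := exists_averaged_center hW (show 0 < N by omega) n
  refine ⟨Q, hQ, hQ1, fun σ => ?_⟩
  have hw := strategyProb_mem_stdSimplex hW n σ
  set w := strategyProb W n σ with hw_def
  have hDle : ∀ b, 0 < b → b < 1 → n * renyiCapacity b W + Real.log N ≤ N * c := by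
    intro b hb0 hb1
    have h1 := renyiCapacity_le_log_card hW hb0 hb1
    have h0 := renyiCapacity_nonneg hW hb0 hb1
    have h2 : n * renyiCapacity b W ≤ N * Real.log (Fintype.card Y) := by gcongr
    nlinarith
  have hDs : ∀ s : ℝ, 0 < s → s ≤ 1 - 1 / N → -Real.log (hellinger w Q s) ≤ (1 - s) * (N * c) := by
    intro s hs0 hs1
    obtain ⟨b, hsb, -, hb1, hb⟩ := H s hs0 hs1
    exact (hb σ).trans (mul_le_mul_of_nonneg_left (hDle b (hs0.trans_le hsb) hb1) (by linarith))
  have hG2 : 2 * c ≤ 2 * c / a₀ ^ 2 := by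
    rw [le_div_iff₀ (by positivity)]
    have : a₀ ^ 2 ≤ 1 := pow_le_one₀ ha0.le ha1.le
    nlinarith
  have hnE : 0 ≤ n * E := mul_nonneg hn0 hE0
  obtain ⟨s, hs, hsT, hsG⟩ := exists_tilting_order hw hQ hQ1 (T := n * R + Real.log N)
    (G := n * E + 2 * c / a₀ ^ 2) ha0 haN (by linarith)
    (by
      obtain ⟨b, hsb, hb', hb1, hb⟩ := H a₀ ha0 haN
      refine (hb σ).trans (mul_le_mul_of_nonneg_left ?_ (by linarith))
      have := hR b (ha0.trans_le hsb) hb' hb1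
      gcongr)
    (by
      intro s hs
      have hs0 : 0 < s := ha0.trans_le hs.1
      obtain ⟨b, hsb, hb', hb1, hb⟩ := H s hs0 hs.2
      have hb0 : 0 < b := hs0.trans_le hsb
      refine (hb σ).trans ?_
      -- replacing the order `s` by `b` costs at most `(b - s) / b` times the capacity
      have h1 : (1 - s) * (renyiCapacity b W - R) ≤
          s * E + 1 / N / a₀ * Real.log (Fintype.card Y) := by
        rcases le_or_gt (renyiCapacity b W) R with hle | hgt
        · have : (1 - s) * (renyiCapacity b W - R) ≤ 0 :=
            mul_nonpos_of_nonneg_of_nonpos (by linarith [hs.2]) (by linarith)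
          have : 0 ≤ 1 / N / a₀ * Real.log (Fintype.card Y) := by positivity
          have := mul_nonneg hs0.le hE0
          linarith
        · have e : (1 - s) * (renyiCapacity b W - R) =
              s * ((1 - b) / b * (renyiCapacity b W - R)) +
                (b - s) / b * (renyiCapacity b W - R) := by
            field_simp
            ring
          rw [e]
          have hR0 : 0 ≤ R := (renyiCapacity_nonneg hW ha0 ha1).trans
            (hR a₀ ha0 (by linarith) ha1)
          have hC := renyiCapacity_le_log_card hW hb0 hb1
          have hab : a₀ ≤ b := hs.1.trans hsb
          refine add_le_add (mul_le_mul_of_nonneg_left (hE b hb0 hb1) hs0.le) ?_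
          refine mul_le_mul ?_ (by linarith) (by linarith) (by positivity)
          exact div_le_div₀ hinv0.le (by linarith) ha0 hab
      have h2 : n * (1 / N / a₀ * Real.log (Fintype.card Y)) ≤ s * (2 * c / a₀ ^ 2) := by
        calc n * (1 / N / a₀ * Real.log (Fintype.card Y))
            ≤ N * (1 / N / a₀ * Real.log (Fintype.card Y)) := by gcongr
          _ = Real.log (Fintype.card Y) / a₀ := by field_simp
          _ ≤ 2 * c / a₀ := by gcongr; linarith
          _ = a₀ * (2 * c / a₀ ^ 2) := by field_simp
          _ ≤ _ := by gcongr; exact hs.1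
      have h3 := mul_le_mul_of_nonneg_left h1 hn0
      linarith)
    (by
      refine (hDs _ (by linarith) le_rfl).trans ?_
      have : (1 - (1 - 1 / (N : ℝ))) * (N * c) = c := by field_simp; ring
      rw [this]
      nlinarith)
  have hs0 : 0 < s := ha0.trans_le hs.1
  have hs1 : s < 1 := by linarith [hs.2]
  have htN : a₀ / N ≤ 1 / N := by gcongr
  have hta : a₀ / N ≤ a₀ := div_le_self ha0.le (by linarith)
  have M := tilted_moments (l := l) (t := a₀ / N) (D := N * c) (c := c) hw hQ hQ1 hs0 hs1
    (hDs s hs0 hs.2) (by positivity) (by positivity) (hta.trans hs.1) (by linarith [hs.2])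
    (by
      calc a₀ / N / s * (N * c) ≤ a₀ / N / a₀ * (N * c) := by gcongr; exact hs.1
        _ = c := by field_simp) hl0 (hl.trans (le_of_eq (by field_simp))) hsT hsG
  have e : l / (a₀ / N) = l * N / a₀ := by field_simp
  rw [e] at M
  exact ⟨tilted w Q s, tilted_mem_stdSimplex hw hQ, fun y hy => tilted_eq_zero hs0.ne' hy, M⟩

end Block

/-! ### The converse -/

section Converse

variable {X Y : Type*} [Fintype Y] {W : Matrix X Y ℝ}

/-- Markov's inequality for a likelihood ratio. -/
lemma sum_filter_le_of_moment {ι : Type*} [Fintype ι] {V R : ι → ℝ} (hV : ∀ i, 0 ≤ V i)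
    (hR : ∀ i, 0 ≤ R i) (h0 : ∀ i, R i = 0 → V i = 0) {l a A : ℝ} (hl : 0 ≤ l)
    (hA : ∑ i, V i * (V i / R i) ^ l ≤ A) :
    ∑ i with Real.exp a * R i < V i, V i ≤ A * Real.exp (-(l * a)) := by
  calc ∑ i with Real.exp a * R i < V i, V i
      ≤ ∑ i with Real.exp a * R i < V i, V i * (V i / R i) ^ l * Real.exp (-(l * a)) := by
        refine sum_le_sum fun i hi => ?_
        rw [mem_filter] at hi
        have hRi : 0 < R i := by
          refine (hR i).lt_of_ne fun h => ?_
          rw [h0 i h.symm, ← h] at hi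
          simp at hi
        have h1 : Real.exp (l * a) ≤ (V i / R i) ^ l := by
          rw [mul_comm, Real.exp_mul]
          refine Real.rpow_le_rpow (Real.exp_pos _).le ?_ hl
          rw [le_div_iff₀ hRi]
          exact hi.2.le
        rw [mul_assoc]
        refine le_mul_of_one_le_right (hV i) ?_
        rw [Real.exp_neg, ← div_eq_mul_inv, one_le_div (Real.exp_pos _)]
        exact h1
    _ ≤ ∑ i, V i * (V i / R i) ^ l * Real.exp (-(l * a)) := by
        refine sum_le_sum_of_subset_of_nonneg (filter_subset _ _) fun i _ _ => ?_
        exact mul_nonneg (mul_nonneg (hV i) (Real.rpow_nonneg (div_nonneg (hV i) (hR i)) _))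
          (Real.exp_pos _).le
    _ ≤ _ := by
        rw [← sum_mul]
        exact mul_le_mul_of_nonneg_right hA (Real.exp_pos _).le

/-- Change of measure: the error probability of a message is bounded below through the auxiliary
distribution, on the set where both likelihood ratios are under control. -/
lemma errorProb_ge_of_moments {ι : Type*} [Fintype ι] {V Q w : ι → ℝ} (hV : V ∈ stdSimplex ℝ ι)
    (hw : w ∈ stdSimplex ℝ ι) (hQ : ∀ i, 0 < Q i) (h0 : ∀ i, w i = 0 → V i = 0) {l a b : ℝ}
    (hl : 0 ≤ l) (hA : ∑ i, V i * (V i / Q i) ^ l ≤ Real.exp (l * a) / 4)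
    (hB : ∑ i, V i * (V i / w i) ^ l ≤ Real.exp (l * b) / 4) (D : ι → Prop) [DecidablePred D] :
    Real.exp (-b) * (1 / 2 - Real.exp a * ∑ i, (if D i then 1 else 0) * Q i) ≤
      1 - ∑ i, (if D i then 1 else 0) * w i := by
  have hA' := sum_filter_le_of_moment (a := a) hV.1 (fun i => (hQ i).le)
    (fun i h => absurd h (hQ i).ne') hl hA
  have hB' := sum_filter_le_of_moment (a := b) hV.1 hw.1 h0 hl hB
  have e : ∀ c : ℝ, Real.exp (l * c) / 4 * Real.exp (-(l * c)) = 1 / 4 := by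
    intro c
    rw [div_mul_eq_mul_div, ← Real.exp_add, add_neg_cancel, Real.exp_zero]
  rw [e] at hA' hB'
  rw [sum_filter] at hA' hB'
  have point : ∀ i, V i ≤ (if Real.exp a * Q i < V i then V i else 0) +
      (if Real.exp b * w i < V i then V i else 0) +
      Real.exp a * ((if D i then 1 else 0) * Q i) +
      Real.exp b * (w i - (if D i then 1 else 0) * w i) := by
    intro i
    have h1 := hV.1 i
    have h2 := mul_nonneg (Real.exp_pos a).le (hQ i).le
    have h3 := mul_nonneg (Real.exp_pos b).le (hw.1 i)
    split_ifs <;> simp only [one_mul, zero_mul, sub_self, sub_zero, mul_zero] <;> linarith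
  have hsum := sum_le_sum fun i (_ : i ∈ univ) => point i
  simp only [sum_add_distrib, ← mul_sum, sum_sub_distrib, hV.2, hw.2] at hsum
  have : 1 / 2 - Real.exp a * ∑ i, (if D i then 1 else 0) * Q i ≤
      Real.exp b * (1 - ∑ i, (if D i then 1 else 0) * w i) := by linarith
  calc _ ≤ Real.exp (-b) * (Real.exp b * (1 - ∑ i, (if D i then 1 else 0) * w i)) := by gcongr
    _ = _ := by rw [← mul_assoc, ← Real.exp_add, neg_add_cancel, Real.exp_zero, one_mul]

lemma avgErrorProb_ge_of_momentBound [Nonempty X] (hW : IsStochasticMatrix W) {n : ℕ}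
    {R l a b A B : ℝ} (hl : 0 ≤ l) (h : MomentBound W l n A B) (hA : A ≤ Real.exp (l * a) / 4)
    (hB : B ≤ Real.exp (l * b) / 4) (haR : Real.exp a ≤ Real.exp (n * R) / 4)
    (c : FeedbackCode X Y n R) :
    Real.exp (-b) / 4 ≤ c.avgErrorProb (fun _ => W) := by
  obtain ⟨Q, hQ, hQ1, H⟩ := h
  have hM : Real.exp (n * R) ≤ numMessages n R := Nat.le_ceil _
  have hMpos : (0 : ℝ) < numMessages n R := (Real.exp_pos _).trans_le hM
  have each : ∀ m, Real.exp (-b) * (1 / 2 - Real.exp a *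
      ∑ y, (if c.dec y = m then 1 else 0) * Q y) ≤ c.errorProb (fun _ => W) m := by
    intro m
    obtain ⟨s, hs⟩ := exists_strategyProb_eq W (c.enc m)
    obtain ⟨V, hV, hV0, hVA, hVB⟩ := H s
    rw [FeedbackCode.errorProb]
    simp only [hs]
    exact errorProb_ge_of_moments hV (strategyProb_mem_stdSimplex hW n s) hQ hV0 hl
      (hVA.trans hA) (hVB.trans hB) fun y => c.dec y = m
  have hsum := sum_le_sum fun m (_ : m ∈ univ) => each m
  have e : ∑ m, ∑ y, (if c.dec y = m then (1 : ℝ) else 0) * Q y = 1 := by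
    rw [sum_comm]
    simpa [← sum_mul] using hQ1
  rw [← mul_sum, sum_sub_distrib, ← mul_sum, e] at hsum
  simp only [sum_const, card_univ, Fintype.card_fin, nsmul_eq_mul, mul_one] at hsum
  rw [FeedbackCode.avgErrorProb, one_div, ← div_eq_inv_mul, le_div_iff₀ hMpos]
  refine le_trans ?_ hsum
  rw [div_mul_eq_mul_div, mul_div_assoc]
  refine mul_le_mul_of_nonneg_left ?_ (Real.exp_pos _).le
  linarith

end Converse

/-! ### Choice of the block length and conclusion -/

/-- The bookkeeping of the error terms for blocks of length `N = ⌈u⌉`, `u = n ^ (1 / 3)`: the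
per-block cost `d`, the quadratic terms of the moments and the constants from Markov's inequality
together stay below `n * approxError n = 2 * u ^ 2 * log n`. -/
lemma block_error_le {n N : ℕ} {u a₀ c d l : ℝ} (hu1 : 1 ≤ u)
    (hu3 : u ^ 3 = n) (hN : u ≤ N) (hN' : N ≤ 2 * u) (ha0 : 0 < a₀)
    (hl : l = a₀ / (2 * N * u)) (hd : 0 ≤ d) (happ : n * approxError n = 2 * u ^ 2 * Real.log n)
    (hlog : 2 * d + 4 / a₀ * (8 * Real.exp c + Real.log 4) + Real.log 4 ≤ 2 * Real.log n) :
    ((n / N : ℕ) + 1) * (l * d + 16 * Real.exp c * (l * N / a₀) ^ 2) + Real.log 4 +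
      l * Real.log 4 ≤ l * (n * approxError n) := by
  have hu0 : 0 < u := by linarith
  have hN0 : (0 : ℝ) < N := by linarith
  have hl0 : 0 < l := by rw [hl]; positivity
  have h4 : 0 ≤ Real.log 4 := Real.log_nonneg (by norm_num)
  have e1 : l * N / a₀ = 1 / (2 * u) := by rw [hl]; field_simp
  have hk : ((n / N : ℕ) : ℝ) + 1 ≤ 2 * u ^ 2 := by
    have h1 : ((n / N : ℕ) : ℝ) ≤ n / N := Nat.cast_div_le
    have h2 : (n : ℝ) / N ≤ u ^ 2 := by
      rw [div_le_iff₀ hN0, ← hu3]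
      nlinarith [sq_nonneg u]
    nlinarith
  have h1 : ((n / N : ℕ) + 1) * (l * d + 16 * Real.exp c * (l * N / a₀) ^ 2) ≤
      l * (2 * u ^ 2 * d) + 8 * Real.exp c := by
    calc _ ≤ 2 * u ^ 2 * (l * d + 16 * Real.exp c * (l * N / a₀) ^ 2) := by gcongr
      _ = _ := by rw [e1]; field_simp; ring
  have h2 : 8 * Real.exp c + Real.log 4 ≤
      l * (u ^ 2 * (4 / a₀ * (8 * Real.exp c + Real.log 4))) := by
    have : 1 ≤ l * (u ^ 2 * (4 / a₀)) := by
      have e : l * (u ^ 2 * (4 / a₀)) = 2 * u / N := by rw [hl]; field_simp; norm_num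
      rw [e, one_le_div hN0]
      exact hN'
    have h0 : 0 ≤ 8 * Real.exp c + Real.log 4 := by positivity
    calc _ ≤ (8 * Real.exp c + Real.log 4) * (l * (u ^ 2 * (4 / a₀))) :=
          le_mul_of_one_le_right h0 this
      _ = _ := by ring
  have h3 : Real.log 4 ≤ u ^ 2 * Real.log 4 :=
    le_mul_of_one_le_left h4 (one_le_pow₀ hu1)
  have h5 : u ^ 2 * (2 * d + 4 / a₀ * (8 * Real.exp c + Real.log 4) + Real.log 4) ≤
      2 * u ^ 2 * Real.log n := by nlinarith [sq_nonneg u]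
  rw [happ]
  have h6 : l * (u ^ 2 * (2 * d) + u ^ 2 * (4 / a₀ * (8 * Real.exp c + Real.log 4)) + Real.log 4) ≤
      l * (2 * u ^ 2 * Real.log n) := by
    apply mul_le_mul_of_nonneg_left _ hl0.le
    linarith
  linarith

theorem theorem1 {X Y : Type*} [Fintype X] [Fintype Y]
    (W : Matrix X Y ℝ) (hW : IsStochasticMatrix W)
    (hC : renyiCapacityZero W ≠ renyiCapacity 1 W)
    (R₀ R₁ : ℝ) (hR₀ : renyiCapacityZero W < R₀) (hR₀₁ : R₀ < R₁) (hR₁ : R₁ < renyiCapacity 1 W) :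
    ∃ n₀ : ℕ, ∀ n : ℕ, n₀ ≤ n → ∀ R : ℝ, R < R₁ → R₀ + approxError n < R →
      ∀ c : FeedbackCode X Y n R,
        EReal.exp (-(((n : ℝ) : EReal) *
            (spherePackingExponent (R - approxError n) W + (approxError n : EReal)))) ≤
          ENNReal.ofReal (c.avgErrorProb (fun _ => W)) := by
  rcases isEmpty_or_nonempty X with hX | hX
  · -- without input letters there is no code of positive length
    refine ⟨1, fun n hn R _ _ c => ?_⟩
    have hM : 0 < numMessages n R := Nat.ceil_pos.2 (Real.exp_pos _)
    exact (hX.false (c.enc ⟨0, hM⟩ ⟨0, hn⟩ Fin.elim0)).elim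
  have hY : Nonempty Y := by
    by_contra h
    rw [not_nonempty_iff] at h
    simpa using (hW (Classical.arbitrary X)).2
  obtain ⟨a, ⟨ha0, ha1⟩, hCa⟩ := exists_renyiCapacity_lt hW hR₀
  set c₁ : ℝ := Real.log (Fintype.card Y) + 1 with hc₁
  have hlY : 0 ≤ Real.log (Fintype.card Y) := Real.log_natCast_nonneg _
  set K : ℝ := 2 * Real.log 2 + 2 * (2 * c₁ / (a / 2) ^ 2) +
    4 / (a / 2) * (8 * Real.exp c₁ + Real.log 4) + Real.log 4 with hK
  have hlim : Filter.Tendsto (fun n : ℕ => (n : ℝ) ^ ((1 : ℝ) / 3)) Filter.atTop Filter.atTop :=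
    (tendsto_rpow_atTop (by norm_num)).comp tendsto_natCast_atTop_atTop
  have hlim' : Filter.Tendsto (fun n : ℕ => Real.log n) Filter.atTop Filter.atTop :=
    Real.tendsto_log_atTop.comp tendsto_natCast_atTop_atTop
  obtain ⟨n₀, hn₀⟩ := Filter.eventually_atTop.1
    ((hlim.eventually_ge_atTop (2 / a)).and (hlim'.eventually_ge_atTop K))
  refine ⟨max n₀ 1, fun n hn R _ hR code => ?_⟩
  obtain ⟨hu, hlogn⟩ := hn₀ n (le_of_max_le_left hn)
  have hn1 : 0 < n := le_of_max_le_right hn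
  have hnR : (0 : ℝ) < n := by exact_mod_cast hn1
  set u : ℝ := (n : ℝ) ^ ((1 : ℝ) / 3) with hu_def
  have hu2 : 2 ≤ 2 / a := by rw [le_div_iff₀ ha0]; linarith
  have hu1 : 1 ≤ u := by linarith
  have hu3 : u ^ 3 = n := by
    rw [hu_def, ← Real.rpow_natCast, ← Real.rpow_mul hnR.le]
    norm_num
  have happ : n * approxError n = 2 * u ^ 2 * Real.log n := by
    rw [approxError, ← hu_def, ← hu3]
    field_simp
  set N : ℕ := ⌈u⌉₊ with hN_def
  have hN1 : u ≤ N := Nat.le_ceil u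
  have hN2 : (N : ℝ) ≤ 2 * u := by linarith [Nat.ceil_lt_add_one (show 0 ≤ u by linarith)]
  have hN3 : 2 ≤ N := by
    have : (2 : ℝ) ≤ N := by linarith
    exact_mod_cast this
  have hNR : (2 : ℝ) ≤ N := by exact_mod_cast hN3
  have hNa : 1 / (N : ℝ) ≤ a / 2 := by
    rw [div_le_div_iff₀ (by linarith) two_pos]
    rw [div_le_iff₀ ha0] at hu
    nlinarith
  have hlogN : Real.log N ≤ Real.log 2 + Real.log n / 3 := by
    calc Real.log N ≤ Real.log (2 * u) := Real.log_le_log (by linarith) hN2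
      _ = _ := by
        rw [Real.log_mul two_ne_zero (by linarith), hu_def, Real.log_rpow hnR]
        ring
  set ε := approxError n with hε
  -- only a finite exponent needs a proof
  rcases eq_or_ne (spherePackingExponent (R - ε) W) ⊤ with htop | htop
  · rw [htop, EReal.top_add_coe, EReal.coe_mul_top_of_pos hnR]
    simp
  have hle : ∀ b, 0 < b → b < 1 →
      (((1 - b) / b * (renyiCapacity b W - (R - ε)) : ℝ) : EReal) ≤
        spherePackingExponent (R - ε) W := fun b hb0 hb1 =>
    le_iSup₂_of_le (f := fun (α : ℝ) (_ : α ∈ Set.Ioo (0 : ℝ) 1) =>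
      (((1 - α) / α * (renyiCapacity α W - (R - ε)) : ℝ) : EReal)) b ⟨hb0, hb1⟩ le_rfl
  have hbot : spherePackingExponent (R - ε) W ≠ ⊥ := fun h => by
    have := hle (1 / 2) (by norm_num) (by norm_num)
    rw [h, le_bot_iff] at this
    exact EReal.coe_ne_bot _ this
  lift spherePackingExponent (R - ε) W to ℝ using ⟨htop, hbot⟩ with E hE_def
  have hE : ∀ b, 0 < b → b < 1 → (1 - b) / b * (renyiCapacity b W - (R - ε)) ≤ E :=
    fun b hb0 hb1 => EReal.coe_le_coe_iff.1 (hle b hb0 hb1)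
  -- the exponent is nonnegative, by the limit of the orders to `1`
  have hE0 : 0 ≤ E := by
    have hcont : ContinuousAt (fun b : ℝ => (1 - b) / b * (-(R - ε))) 1 :=
      ((continuousAt_const.sub continuousAt_id).div continuousAt_id one_ne_zero).mul
        continuousAt_const
    have ht : Filter.Tendsto (fun b : ℝ => (1 - b) / b * (-(R - ε)))
        (nhdsWithin 1 (Set.Iio 1)) (nhds 0) := by
      have := hcont.tendsto.mono_left (nhdsWithin_le_nhds (s := Set.Iio 1))
      simpa using this
    refine le_of_tendsto ht ?_
    filter_upwards [Ioo_mem_nhdsLT (zero_lt_one' ℝ)] with b hb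
    refine le_trans (mul_le_mul_of_nonneg_left ?_ (div_nonneg (by linarith [hb.2]) hb.1.le))
      (hE b hb.1 hb.2)
    linarith [renyiCapacity_nonneg hW hb.1 hb.2]
  set l : ℝ := a / 2 / (2 * N * u) with hl
  have hl0 : 0 < l := by positivity
  have hblock : ∀ m ≤ N, MomentBound W l m
      (Real.exp (m * (l * (R - ε)) +
        (l * Real.log N + 16 * Real.exp c₁ * (l * N / (a / 2)) ^ 2)))
      (Real.exp (m * (l * E) +
        (l * (2 * c₁ / (a / 2) ^ 2) + 16 * Real.exp c₁ * (l * N / (a / 2)) ^ 2))) := by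
    intro m hm
    have := momentBound_block hW (a₀ := a / 2) (R := R - ε) (E := E) (l := l) hN3 (by linarith)
      (by linarith) (fun b hb0 hba _ => by linarith [hCa b hb0 (by linarith)]) hE0 hE hl0.le
      (by
        rw [hl]
        refine div_le_div_of_nonneg_left (by linarith) (by linarith) ?_
        exact le_mul_of_one_le_right (by linarith) hu1)
      hc₁.symm.le hm
    convert this using 2 <;> ring
  have hall := MomentBound.of_blocks hW (show 0 < N by omega) hblock n
  have hpos : 0 ≤ 2 * c₁ / (a / 2) ^ 2 := by positivity
  have hlog2 : 0 ≤ Real.log 2 := Real.log_nonneg (by norm_num)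
  have hlog4 : 0 ≤ Real.log 4 := Real.log_nonneg (by norm_num)
  have hpos' : 0 ≤ 4 / (a / 2) * (8 * Real.exp c₁ + Real.log 4) := by positivity
  have hA := block_error_le (d := Real.log N) (c := c₁) hu1 hu3 hN1 hN2
    (show 0 < a / 2 by linarith) hl (Real.log_natCast_nonneg _) happ (by linarith)
  have hB := block_error_le (d := 2 * c₁ / (a / 2) ^ 2) (c := c₁) hu1 hu3 hN1 hN2
    (show 0 < a / 2 by linarith) hl hpos happ (by linarith)
  have e4 : ∀ x : ℝ, Real.exp x / 4 = Real.exp (x - Real.log 4) := fun x => by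
    rw [Real.exp_sub, Real.exp_log (by norm_num)]
  have main := avgErrorProb_ge_of_momentBound hW (a := n * R - Real.log 4)
    (b := n * (E + ε) - Real.log 4) hl0.le hall
    (by rw [e4]; apply Real.exp_le_exp.2; linarith)
    (by rw [e4]; apply Real.exp_le_exp.2; linarith)
    (by rw [e4]) code
  rw [e4] at main
  have eE : -(((n : ℝ) : EReal) * ((E : EReal) + (ε : EReal))) =
      ((-(n * (E + ε)) : ℝ) : EReal) := by
    push_cast
    rfl
  rw [eE, EReal.exp_coe]
  refine ENNReal.ofReal_le_ofReal (le_trans (le_of_eq ?_) main)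
  congr 1
  ring
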